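/- Let $\mathbb{T}=\mathbb{R}/2\pi\mathbb{Z}$ with Lebesgue measure $dx$, and write $W^{k,1}=W^{k,1}(\mathbb{T})$ for the Sobolev spaces, normed by the sum of the $L^1$ norms of the weak derivatives of order at most $k$. Let $P_w$ be the set of probability densities in $L^1(\mathbb{T})$. Let $T:\mathbb{T}\to\mathbb{T}$ be a $C^4$ uniformly expanding map, i.e. $|T'|>\sigma$ everywhere for some $\sigma>1$, and let $L_T:L^1(\mathbb{T})\to L^1(\mathbb{T})$ be its transfer operator: $L_T f$ is the density of the push-forward $T_*(f\,dx)$. For $\phi\in L^1(\mathbb{T})$ put $$W_\phi=\Big|\int_{\mathbb{T}}e^{ix}\phi(x)\,dx\Big|^2 .$$ For every $\delta\in[0,1]$ and $\phi\in P_w$ let $\psi_{\delta,\phi}\in W^{2,1}$ be a probability density, and suppose that there are constants $M,C\ge 0$, independent of $\delta$ and $\phi$, with $$\|\psi_{\delta,\phi}\|_{W^{2,1}}\le M,\qquad \|\psi_{\delta,\phi_1}-\psi_{\delta,\phi_2}\|_{W^{1,1}}\le C\,\|\phi_1-\phi_2\|_{L^1}\qquad(\delta\in[0,1],\ \phi,\phi_1,\phi_2\in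 P_w).$$ (The case where $\psi_{\delta,\phi}=\psi_\phi$ does not depend on $\delta$ is included.) For $\delta\in[0,1]$ and $\phi\in P_w$ define on $L^1(\mathbb{T})$ $$L_{\delta,\phi}(f)=\begin{cases}(1-\delta W_\phi)\,L_T(f)+\big[\delta W_\phi\int_{\mathbb{T}} f\,dx\big]\,\psi_{\delta,\phi} & \text{if }\delta W_\phi\le 1,\\[2pt] \psi_{\delta,\phi}\int_{\mathbb{T}} f\,dx & \text{if }\delta W_\phi>1,\end{cases}$$ and the self-consistent transfer operator $\mathcal{L}_\delta(f)=L_{\delta,f}(f)$ for $f\in P_w$. Suppose that $T$ has an invariant probability density $h_0\in W^{3,1}$ (that is, $L_Th_0=h_0$) with $W_{h_0}=0$. Then there is $\bar\delta$ with $0<\bar\delta<1$ such that for every $\delta$ with $0\le\delta\le\bar\delta$, $h_0$ is the unique invariant probability density of $\mathcal{L}_\delta$ in $L^1(\mathbb{T})$: for $f\in P_w$ one has $\mathcal{L}_\delta(f)=f$ if and only if $f=h_0$. -/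

import Mathlib

open MeasureTheory
open scoped ENNReal NNReal ContDiff

noncomputable section

/-- The circle `ℝ / 2πℤ`, with Lebesgue measure `volume` of total mass `2π`. -/
abbrev Torus : Type := AddCircle (2 * Real.pi)

instance torusPeriodPos : Fact (0 < 2 * Real.pi) := ⟨Real.two_pi_pos⟩

/-- Real `L¹(𝕋)`, as a space of classes of functions modulo almost everywhere equality. -/
abbrev L1Torus : Type := Lp ℝ 1 (volume : Measure Torus)

/-- A uniformly expanding `C⁴` map of the circle: it has a `C⁴` lift `F : ℝ → ℝ` with
`|F'| > σ` everywhere, for some `σ > 1`. -/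
def IsExpandingC4 (T : Torus → Torus) : Prop :=
  ∃ F : ℝ → ℝ, ContDiff ℝ 4 F ∧ (∀ x : ℝ, T (x : Torus) = (F x : Torus)) ∧
    ∃ σ : ℝ, 1 < σ ∧ ∀ x : ℝ, σ < |deriv F x|

/-- The transfer operator of `T` on densities: `L_T f` is the density with respect to Lebesgue
measure of the push-forward under `T` of the signed measure `f dx`. -/
def transferOp (T : Torus → Torus) (f : L1Torus) : L1Torus :=
  (SignedMeasure.integrable_rnDeriv
    (VectorMeasure.map ((volume : Measure Torus).withDensityᵥ (f : Torus → ℝ)) T)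
    (volume : Measure Torus)).toL1 _

/-- Derivative of a function on the circle. -/
def circleDeriv (η : Torus → ℝ) (x : Torus) : ℝ :=
  deriv (fun t : ℝ => η (x + (t : Torus))) 0

/-- `g` is the weak derivative of `f` on the circle, tested against smooth functions. -/
def HasWeakDeriv (f g : L1Torus) : Prop :=
  ∀ η : Torus → ℝ, ContDiff ℝ ∞ (fun t : ℝ => η (t : Torus)) →
    ∫ x, f x * circleDeriv η x = - ∫ x, g x * η x

/-- The norm of `W^{k,1}(𝕋)`, `∑_{i ≤ k} ‖f⁽ⁱ⁾‖_{L¹}` with weak derivatives `f⁽ⁱ⁾`, set to `∞` when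
`f` is not in `W^{k,1}(𝕋)`.  The weak derivative is unique when it exists, so that the infimum runs
over at most one `g`. -/
def sobolevNorm : ℕ → L1Torus → ℝ≥0∞
  | 0, f => ‖f‖ₑ
  | k + 1, f => ‖f‖ₑ + ⨅ (g : L1Torus) (_ : HasWeakDeriv f g), sobolevNorm k g

/-- Membership in `W^{k,1}(𝕋)`. -/
def MemSobolev (k : ℕ) (f : L1Torus) : Prop := sobolevNorm k f < ⊤

/-- Probability densities in `L¹(𝕋)`. -/
def IsProbDensity (f : L1Torus) : Prop :=
  (∀ᵐ x : Torus, 0 ≤ f x) ∧ ∫ x, f x = 1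

/-- The weight of the barycenter, `W_φ = |∫ e^{ix} φ(x) dx|²`. On `ℝ / 2πℤ` the function
`fourier 1` is `x ↦ e^{ix}`. -/
def baryWeight (φ : L1Torus) : ℝ :=
  ‖∫ x : Torus, (fourier 1 x : ℂ) * ((φ x : ℝ) : ℂ)‖ ^ 2

open Classical in
/-- The operator `L_{δ,φ}` of the system in the state `φ`, where `ψφ` is the density to which
a subsystem may switch. -/
def coupledOp (T : Torus → Torus) (δ : ℝ) (φ ψφ f : L1Torus) : L1Torus :=
  if δ * baryWeight φ ≤ 1 then
    (1 - δ * baryWeight φ) • transferOp T f + (δ * baryWeight φ * ∫ x, f x) • ψφ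
  else (∫ x, f x) • ψφ

/-- The self-consistent transfer operator `f ↦ L_{δ,f} f`. -/
def selfConsistentOp (T : Torus → Torus) (ψ : L1Torus → L1Torus) (δ : ℝ) (f : L1Torus) : L1Torus :=
  coupledOp T δ f (ψ f) f

end

/-! Put `a = δ W_f`. A fixed point satisfies `f = (1 - a) L f + a ψ` with `L = L_T`, and `L h₀ = h₀`
gives `f - h₀ = (1 - a) L (f - h₀) + a (ψ - h₀)`. Iterating turns this into `f - h₀ = a ∑ (1 - a)^k
L^k (ψ - h₀)`. If `L^k` decays geometrically on `ψ - h₀`, then `‖f - h₀‖ ≤ a K'` with `K'`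
independent of `δ` and `f` (`norm_sub_le_of_eq_convexCombination`). The weight is the squared
modulus of a functional of norm at most 1 that vanishes at `h₀`, so `W_f ≤ ‖f - h₀‖² ≤ δ² W_f² K'²`.
Since `W_f ≤ 1`, small `δ` forces `a = 0`: `f` is invariant under `T`, and an expanding map has only
one invariant density (`IsExpandingC4.eq_of_transferOp_eq`).

The decay comes from a cone argument instead of spectral theory. Inverse branches contract, so `L`
shrinks the log-Hölder constant up to an additive distortion term. The room gained allows a fixed
fraction of the mass to be removed as a constant function at each step; two densities of equal mass
lose the same constant, and what remains of each shrinks geometrically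
(`IsExpandingC4.exists_cone_decay`).

Bounded sets of `W^{2,1}` are brought into a cone by Fourier series: coefficients of order `n⁻²`
give uniform Hölder continuity of exponent `1/2`, and adding a constant makes the logarithm Hölder.
-/

noncomputable section

/-! ### Log-Hölder cone, increasing lifts and their inverse branches -/

/-- Nonnegative continuous functions on the circle whose logarithm has modulus of continuity
`A √|t|`. -/
structure LogHolder (A : ℝ) (u : Torus → ℝ) : Prop where
  continuous : Continuous u
  nonneg : ∀ x, 0 ≤ u x
  le : ∀ (x : Torus) (t : ℝ), |t| ≤ 2 * Real.pi → u (x + t) ≤ Real.exp (A * √|t|) * u x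

/-- An increasing lift of an expanding circle map with expansion rate `σ`. -/
structure IsExpandingLift (σ : ℝ) (F : ℝ → ℝ) : Prop where
  contDiff : ContDiff ℝ 2 F
  one_lt : 1 < σ
  lt_deriv : ∀ x, σ < deriv F x
  coe_add : ∀ x, ((F (x + 2 * Real.pi) : ℝ) : Torus) = (F x : Torus)

namespace IsExpandingLift

variable {σ : ℝ} {F : ℝ → ℝ}

theorem deriv_pos (h : IsExpandingLift σ F) (x : ℝ) : 0 < deriv F x := by
  linarith [h.one_lt, h.lt_deriv x]

theorem hasDerivAt (h : IsExpandingLift σ F) (x : ℝ) : HasDerivAt F (deriv F x) x :=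
  ((h.contDiff.differentiable (by norm_num)) x).hasDerivAt

theorem contDiff_deriv (h : IsExpandingLift σ F) : ContDiff ℝ 1 (deriv F) :=
  (contDiff_succ_iff_deriv (n := 1)).1 (by simpa [one_add_one_eq_two] using h.contDiff) |>.2.2

theorem strictMono (h : IsExpandingLift σ F) : StrictMono F :=
  strictMono_of_deriv_pos h.deriv_pos

theorem mul_sub_le (h : IsExpandingLift σ F) {x y : ℝ} (hxy : x ≤ y) :
    σ * (y - x) ≤ F y - F x :=
  mul_sub_le_image_sub_of_le_deriv (h.contDiff.differentiable (by norm_num))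
    (fun x => (h.lt_deriv x).le) hxy

/-- The increment over a period is continuous with values in `2πℤ`, hence constant; it is
nonnegative because the lift increases. -/
theorem exists_degree (h : IsExpandingLift σ F) :
    ∃ d : ℕ, ∀ x, F (x + 2 * Real.pi) = F x + d * (2 * Real.pi) := by
  have h1 : ∀ x, ∃ n : ℤ, F (x + 2 * Real.pi) - F x = n * (2 * Real.pi) := by
    intro x
    have := h.coe_add x
    rw [← sub_eq_zero, ← AddCircle.coe_sub, AddCircle.coe_eq_zero_iff] at this
    obtain ⟨n, hn⟩ := this
    exact ⟨n, by rw [← hn]; simp⟩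
  choose n hn using h1
  have hcont : Continuous n := by
    rw [Int.isClosedEmbedding_coe_real.isInducing.continuous_iff]
    have : ((↑) : ℤ → ℝ) ∘ n = fun x => (F (x + 2 * Real.pi) - F x) / (2 * Real.pi) := by
      ext x
      rw [hn x, mul_div_cancel_right₀ _ Real.two_pi_pos.ne']; rfl
    rw [this]
    have := h.contDiff.continuous
    fun_prop
  have hpos : 0 ≤ n 0 := by
    have h2 := hn 0
    have h3 := h.strictMono (show (0 : ℝ) < 0 + 2 * Real.pi by linarith [Real.two_pi_pos])
    by_contra hneg
    push Not at hneg
    have : (n 0 : ℝ) < 0 := by exact_mod_cast hneg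
    nlinarith [Real.two_pi_pos]
  refine ⟨(n 0).toNat, fun x => ?_⟩
  have h4 : n x = n 0 := PreconnectedSpace.constant inferInstance hcont
  have h5 : (((n 0).toNat : ℕ) : ℝ) = n 0 := by exact_mod_cast Int.toNat_of_nonneg hpos
  rw [h5, ← h4]
  linarith [hn x]

theorem surjective (h : IsExpandingLift σ F) : Function.Surjective F := by
  have hσ : 0 < σ := by linarith [h.one_lt]
  refine h.contDiff.continuous.surjective ?_ ?_
  · refine Filter.tendsto_atTop_mono' _ ?_
      (Filter.tendsto_atTop_add_const_left _ (F 0) (Filter.tendsto_id.const_mul_atTop hσ))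
    filter_upwards [Filter.eventually_ge_atTop 0] with x hx
    have := h.mul_sub_le hx
    simp only [id]; linarith
  · refine Filter.tendsto_atBot_mono' _ ?_
      (Filter.tendsto_atBot_add_const_left _ (F 0) (Filter.tendsto_id.const_mul_atBot hσ))
    filter_upwards [Filter.eventually_le_atBot 0] with x hx
    have := h.mul_sub_le hx
    simp only [id]; linarith

/-- The inverse of an expanding lift. -/
def inv (h : IsExpandingLift σ F) : ℝ ≃o ℝ :=
  (h.strictMono.orderIsoOfSurjective F h.surjective).symm

theorem apply_inv (h : IsExpandingLift σ F) (y : ℝ) : F (h.inv y) = y :=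
  (h.strictMono.orderIsoOfSurjective F h.surjective).apply_symm_apply y

theorem inv_apply (h : IsExpandingLift σ F) (x : ℝ) : h.inv (F x) = x :=
  (h.strictMono.orderIsoOfSurjective F h.surjective).symm_apply_apply x

theorem continuous_inv (h : IsExpandingLift σ F) : Continuous h.inv := h.inv.continuous

theorem hasDerivAt_inv (h : IsExpandingLift σ F) (y : ℝ) :
    HasDerivAt h.inv (deriv F (h.inv y))⁻¹ y :=
  HasDerivAt.of_local_left_inverse h.continuous_inv.continuousAt (h.hasDerivAt _)
    (h.deriv_pos _).ne' (Filter.Eventually.of_forall h.apply_inv)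

theorem abs_inv_sub_le (h : IsExpandingLift σ F) (x y : ℝ) :
    |h.inv x - h.inv y| ≤ |x - y| / σ := by
  have hσ : 0 < σ := by linarith [h.one_lt]
  wlog hxy : y ≤ x generalizing x y
  · rw [abs_sub_comm, abs_sub_comm x]; exact this y x (le_of_not_ge hxy)
  have := h.mul_sub_le (h.inv.monotone hxy)
  rw [h.apply_inv, h.apply_inv] at this
  rw [abs_of_nonneg (sub_nonneg.2 (h.inv.monotone hxy)), abs_of_nonneg (sub_nonneg.2 hxy),
    le_div_iff₀ hσ]
  linarith

theorem inv_add {d : ℕ} (h : IsExpandingLift σ F)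
    (hd : ∀ x, F (x + 2 * Real.pi) = F x + d * (2 * Real.pi)) (y : ℝ) :
    h.inv (y + d * (2 * Real.pi)) = h.inv y + 2 * Real.pi := by
  apply h.strictMono.injective
  rw [h.apply_inv, hd, h.apply_inv]

theorem periodic_deriv (h : IsExpandingLift σ F) : (deriv F).Periodic (2 * Real.pi) := by
  obtain ⟨d, hd⟩ := h.exists_degree
  intro x
  rw [← deriv_comp_add_const]
  simp only [hd, deriv_add_const]

/-- Bounded distortion: `log F'` is Lipschitz, because `F''` is continuous and periodic, hence
bounded, while `F' ≥ 1`. -/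
theorem exists_deriv_le_exp_mul (h : IsExpandingLift σ F) :
    ∃ B : ℝ, 0 ≤ B ∧ ∀ x y, deriv F x ≤ Real.exp (B * |x - y|) * deriv F y := by
  have hc : Continuous (deriv (deriv F)) := h.contDiff_deriv.continuous_deriv (by norm_num)
  have hp : (deriv (deriv F)).Periodic (2 * Real.pi) := by
    intro x
    rw [← deriv_comp_add_const]
    simp only [h.periodic_deriv _]
  obtain ⟨B, hB⟩ := (hp.isBounded_of_continuous Real.two_pi_pos.ne' hc).exists_norm_le
  have hB' : ∀ x, ‖deriv (deriv F) x‖ ≤ B := fun x => hB _ ⟨x, rfl⟩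
  have hB0 : 0 ≤ B := (norm_nonneg _).trans (hB' 0)
  refine ⟨B, hB0, fun x y => ?_⟩
  have hd : ∀ x, HasDerivAt (fun x => Real.log (deriv F x)) (deriv (deriv F) x / deriv F x) x :=
    fun x => ((h.contDiff_deriv.differentiable (by norm_num)) x).hasDerivAt.log (h.deriv_pos x).ne'
  have key := Convex.norm_image_sub_le_of_norm_hasDerivWithin_le (C := B) (s := Set.univ)
    (fun x _ => (hd x).hasDerivWithinAt) (fun x _ => by
      rw [norm_div]
      refine div_le_of_le_mul₀ (norm_nonneg _) hB0 ((hB' x).trans ?_)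
      have : 1 ≤ ‖deriv F x‖ := by
        rw [Real.norm_of_nonneg (h.deriv_pos x).le]; linarith [h.one_lt, h.lt_deriv x]
      nlinarith) convex_univ (Set.mem_univ y) (Set.mem_univ x)
  rw [Real.norm_eq_abs, Real.norm_eq_abs] at key
  have := (le_abs_self _).trans key
  calc deriv F x = Real.exp (Real.log (deriv F x)) := (Real.exp_log (h.deriv_pos x)).symm
    _ ≤ Real.exp (B * |x - y| + Real.log (deriv F y)) := Real.exp_le_exp.2 (by linarith)
    _ = _ := by rw [Real.exp_add, Real.exp_log (h.deriv_pos y)]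

/-- The summand of the transfer operator of `F` over one inverse branch. -/
def branch (h : IsExpandingLift σ F) (u : Torus → ℝ) (y : ℝ) : ℝ :=
  (deriv F (h.inv y))⁻¹ * u (h.inv y : Torus)

theorem continuous_branch (h : IsExpandingLift σ F) {u : Torus → ℝ} (hu : Continuous u) :
    Continuous (h.branch u) := by
  have h1 := h.continuous_inv
  have h2 := h.contDiff_deriv.continuous
  refine Continuous.mul (Continuous.inv₀ (h2.comp h1) fun x => (h.deriv_pos _).ne') ?_
  exact hu.comp ((AddCircle.continuous_mk' _).comp h1)

/-- The lift has a single global inverse, so one change of variables handles all branches: a period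
of the source corresponds to an interval of `d` periods in the target. -/
theorem integral_comp_mul (h : IsExpandingLift σ F) {d : ℕ}
    (hd : ∀ x, F (x + 2 * Real.pi) = F x + d * (2 * Real.pi)) {T : Torus → Torus}
    (hT : ∀ x : ℝ, T x = (F x : Torus)) (u g : Torus → ℝ) :
    ∫ x, g (T x) * u x = ∫ y in F 0..F 0 + d * (2 * Real.pi), g (y : Torus) * h.branch u y := by
  have himage : h.inv '' Set.Ioc (F 0) (F 0 + d * (2 * Real.pi)) = Set.Ioc 0 (0 + 2 * Real.pi) := by
    rw [h.inv.image_Ioc, h.inv_add hd, h.inv_apply]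
  rw [← AddCircle.integral_preimage _ 0, ← himage,
    integral_image_eq_integral_abs_deriv_smul measurableSet_Ioc
      (fun y _ => (h.hasDerivAt_inv y).hasDerivWithinAt) h.inv.injective.injOn,
    intervalIntegral.integral_of_le (le_add_of_nonneg_right (mul_nonneg d.cast_nonneg Real.two_pi_pos.le))]
  refine setIntegral_congr_fun measurableSet_Ioc fun y _ => ?_
  simp only [hT, h.apply_inv, branch, smul_eq_mul, abs_of_pos (inv_pos.2 (h.deriv_pos _))]
  ring

/-- The transfer operator of `F` on functions, in the coordinate `ℝ`. -/
def branchSum (h : IsExpandingLift σ F) (d : ℕ) (u : Torus → ℝ) (y : ℝ) : ℝ :=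
  ∑ k ∈ Finset.range d, h.branch u (y + k * (2 * Real.pi))

/-- A shift by one period permutes the `d` summands cyclically, since `inv` advances by a full
period after `d` of them. -/
theorem periodic_branchSum (h : IsExpandingLift σ F) {d : ℕ}
    (hd : ∀ x, F (x + 2 * Real.pi) = F x + d * (2 * Real.pi)) (u : Torus → ℝ) :
    (h.branchSum d u).Periodic (2 * Real.pi) := by
  intro y
  have h1 : ∀ k : ℕ, h.branch u (y + 2 * Real.pi + k * (2 * Real.pi))
      = h.branch u (y + (k + 1 : ℕ) * (2 * Real.pi)) := fun k => by
    congr 1; push_cast; ring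
  have h2 : h.branch u (y + d * (2 * Real.pi)) = h.branch u (y + (0 : ℕ) * (2 * Real.pi)) := by
    simp only [branch, h.inv_add hd, h.periodic_deriv _, AddCircle.coe_add_period]
    simp
  simp only [branchSum, h1]
  have h3 := Finset.sum_range_succ' (fun k : ℕ => h.branch u (y + k * (2 * Real.pi))) d
  rw [Finset.sum_range_succ, h2] at h3
  linarith

theorem continuous_branchSum (h : IsExpandingLift σ F) (d : ℕ) {u : Torus → ℝ}
    (hu : Continuous u) : Continuous (h.branchSum d u) := by
  have := h.continuous_branch hu
  unfold branchSum
  fun_prop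

theorem branch_nonneg (h : IsExpandingLift σ F) {u : Torus → ℝ} (hu : ∀ x, 0 ≤ u x) (y : ℝ) :
    0 ≤ h.branch u y :=
  mul_nonneg (inv_nonneg.2 (h.deriv_pos _).le) (hu _)

/-- The inverse branch shortens `t` by `1/σ`, which divides the Hölder constant by `√σ`. Distortion
costs `B|t|`, and `|t| ≤ √(2π) √|t|` on the allowed range turns it into the additive term. -/
theorem branch_add_le (h : IsExpandingLift σ F) {B : ℝ} (hB0 : 0 ≤ B)
    (hB : ∀ x y, deriv F x ≤ Real.exp (B * |x - y|) * deriv F y) {A : ℝ} (hA : 0 ≤ A)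
    {u : Torus → ℝ} (hu : LogHolder A u) (y : ℝ) {t : ℝ} (ht : |t| ≤ 2 * Real.pi) :
    h.branch u (y + t)
      ≤ Real.exp ((A / √σ + B * √(2 * Real.pi)) * √|t|) * h.branch u y := by
  have hσ : 0 < σ := by linarith [h.one_lt]
  set s := h.inv (y + t) - h.inv y with hs
  have hst : |s| ≤ |t| / σ := by simpa using h.abs_inv_sub_le (y + t) y
  have hst' : |t| / σ ≤ |t| := div_le_self (abs_nonneg _) h.one_lt.le
  have h1 : u (h.inv (y + t) : Torus) ≤ Real.exp (A / √σ * √|t|) * u (h.inv y : Torus) := by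
    have := hu.le (h.inv y : Torus) s (hst.trans (hst'.trans ht))
    rw [← AddCircle.coe_add, hs, add_sub_cancel] at this
    refine this.trans (mul_le_mul_of_nonneg_right (Real.exp_le_exp.2 ?_) (hu.nonneg _))
    rw [div_mul_eq_mul_div, mul_div_assoc, ← Real.sqrt_div' _ hσ.le]
    exact mul_le_mul_of_nonneg_left (Real.sqrt_le_sqrt hst) hA
  have h2 : (deriv F (h.inv (y + t)))⁻¹
      ≤ Real.exp (B * √(2 * Real.pi) * √|t|) * (deriv F (h.inv y))⁻¹ := by
    rw [← div_eq_mul_inv, le_div_iff₀ (h.deriv_pos _), inv_mul_le_iff₀ (h.deriv_pos _), mul_comm]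
    refine (hB (h.inv y) (h.inv (y + t))).trans
      (mul_le_mul_of_nonneg_right (Real.exp_le_exp.2 ?_) (h.deriv_pos _).le)
    rw [abs_sub_comm, mul_assoc]
    refine mul_le_mul_of_nonneg_left ((hst.trans hst').trans ?_) hB0
    calc |t| = √|t| * √|t| := (Real.mul_self_sqrt (abs_nonneg t)).symm
      _ ≤ _ := mul_le_mul_of_nonneg_right (Real.sqrt_le_sqrt ht) (Real.sqrt_nonneg _)
  calc h.branch u (y + t) ≤ (Real.exp (B * √(2 * Real.pi) * √|t|) * (deriv F (h.inv y))⁻¹) *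
        (Real.exp (A / √σ * √|t|) * u (h.inv y : Torus)) :=
        mul_le_mul h2 h1 (hu.nonneg _)
          (mul_nonneg (Real.exp_pos _).le (inv_nonneg.2 (h.deriv_pos _).le))
    _ = _ := by rw [add_mul, Real.exp_add]; unfold branch; ring

theorem setIntegral_branchSum (h : IsExpandingLift σ F) {d : ℕ}
    (hd : ∀ x, F (x + 2 * Real.pi) = F x + d * (2 * Real.pi)) {T : Torus → Torus}
    (hT : ∀ x : ℝ, T x = (F x : Torus)) (hTm : Measurable T) {u : Torus → ℝ} (hu : Continuous u)
    {E : Set Torus} (hE : MeasurableSet E) :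
    ∫ x in E, (h.periodic_branchSum hd u).lift x = ∫ x in T ⁻¹' E, u x := by
  have hE' : MeasurableSet ((fun y : ℝ => (y : Torus)) ⁻¹' E) := AddCircle.measurable_mk' hE
  rw [← integral_indicator hE, ← integral_indicator (hTm hE)]
  have h1 : (T ⁻¹' E).indicator u = fun x => E.indicator 1 (T x) * u x := by
    ext x
    by_cases hx : T x ∈ E
    · simp [hx]
    · simp [hx]
  have h2 : ∀ c : ℝ → ℝ, Continuous c → ∀ a b, IntervalIntegrable
      (fun y : ℝ => E.indicator (1 : Torus → ℝ) (y : Torus) * c y) volume a b := by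
    intro c hc a b
    have : (fun y : ℝ => E.indicator (1 : Torus → ℝ) (y : Torus) * c y)
        = ((fun y : ℝ => (y : Torus)) ⁻¹' E).indicator c := by
      ext y
      by_cases hy : (y : Torus) ∈ E
      · simp [hy]
      · simp [hy]
    rw [this]
    exact ⟨(hc.intervalIntegrable a b).1.indicator hE', (hc.intervalIntegrable a b).2.indicator hE'⟩
  have hbc := h.continuous_branch hu
  rw [h1, h.integral_comp_mul hd hT, ← AddCircle.intervalIntegral_preimage _ (F 0)]
  -- The interval of `d` periods is cut into single periods, each translated back to the first; the
  -- indicator is unchanged by the translation.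
  have h3 := intervalIntegral.sum_integral_adjacent_intervals (μ := volume)
    (a := fun k : ℕ => F 0 + k * (2 * Real.pi)) (n := d)
    (f := fun y : ℝ => E.indicator (1 : Torus → ℝ) (y : Torus) * h.branch u y)
    (fun k _ => h2 _ hbc _ _)
  simp only [Nat.cast_zero, zero_mul, add_zero] at h3
  rw [← h3]
  have h4 : ∀ k : ℕ, ∫ y in F 0 + k * (2 * Real.pi)..F 0 + (k + 1 : ℕ) * (2 * Real.pi),
        E.indicator (1 : Torus → ℝ) (y : Torus) * h.branch u y
      = ∫ y in F 0..F 0 + 2 * Real.pi,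
        E.indicator (1 : Torus → ℝ) (y : Torus) * h.branch u (y + k * (2 * Real.pi)) := by
    intro k
    have h5 : ∀ y : ℝ, ((y + k * (2 * Real.pi) : ℝ) : Torus) = (y : Torus) := fun y => by
      rw [← nsmul_eq_mul, AddCircle.coe_add, AddCircle.coe_nsmul, AddCircle.coe_period, smul_zero,
        add_zero]
    have := intervalIntegral.integral_comp_add_right (a := F 0) (b := F 0 + 2 * Real.pi)
      (fun y : ℝ => E.indicator (1 : Torus → ℝ) (y : Torus) * h.branch u y) (k * (2 * Real.pi))
    simp only [h5] at this
    rw [this]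
    congr 1
    push_cast; ring
  simp only [h4]
  rw [← intervalIntegral.integral_finsetSum (fun k _ => h2 _ (by fun_prop) _ _)]
  refine intervalIntegral.integral_congr fun y _ => ?_
  simp only [← Finset.mul_sum]
  by_cases hy : (y : Torus) ∈ E
  · simp [hy, branchSum]
  · simp [hy]

theorem logHolder_branchSum (h : IsExpandingLift σ F) {d : ℕ}
    (hd : ∀ x, F (x + 2 * Real.pi) = F x + d * (2 * Real.pi)) {B : ℝ} (hB0 : 0 ≤ B)
    (hB : ∀ x y, deriv F x ≤ Real.exp (B * |x - y|) * deriv F y) {A : ℝ} (hA : 0 ≤ A)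
    {u : Torus → ℝ} (hu : LogHolder A u) :
    LogHolder (A / √σ + B * √(2 * Real.pi)) (h.periodic_branchSum hd u).lift where
  continuous := continuous_coinduced_dom.2 (h.continuous_branchSum d hu.continuous)
  nonneg x := by
    induction x using QuotientAddGroup.induction_on with | _ x =>
    exact Finset.sum_nonneg (s := Finset.range d) fun k _ => h.branch_nonneg hu.nonneg _
  le x t ht := by
    induction x using QuotientAddGroup.induction_on with | _ x =>
    rw [← AddCircle.coe_add, Function.Periodic.lift_coe, Function.Periodic.lift_coe, branchSum,
      branchSum, Finset.mul_sum]
    refine Finset.sum_le_sum fun k _ => ?_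
    rw [add_right_comm]
    exact h.branch_add_le hB0 hB hA hu _ ht

end IsExpandingLift

/-! ### Expanding circle maps of either orientation -/

theorem LogHolder.comp_neg {A : ℝ} {u : Torus → ℝ} (hu : LogHolder A u) :
    LogHolder A fun x => u (-x) where
  continuous := hu.continuous.comp continuous_neg
  nonneg x := hu.nonneg _
  le x t ht := by
    have := hu.le (-x) (-t) (by rwa [abs_neg])
    rw [abs_neg] at this
    rwa [neg_add, ← AddCircle.coe_neg]

theorem IsExpandingC4.measurable {T : Torus → Torus} (hT : IsExpandingC4 T) : Measurable T := by
  obtain ⟨F, hF, hTF, -⟩ := hT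
  refine Continuous.measurable (continuous_coinduced_dom.2 ?_)
  have : T ∘ (QuotientAddGroup.mk : ℝ → Torus) = fun x : ℝ => (F x : Torus) := funext hTF
  exact (this ▸ (AddCircle.continuous_mk' _).comp hF.continuous :
    Continuous (T ∘ (QuotientAddGroup.mk : ℝ → Torus)))

/-- By the intermediate value theorem `F'` cannot change sign without vanishing. If it is negative,
`-F` is an increasing lift of `-T`, so the decreasing case reduces to the increasing one by
reflection. -/
theorem IsExpandingC4.exists_lift {T : Torus → Torus} (hT : IsExpandingC4 T) :
    ∃ (σ : ℝ) (F : ℝ → ℝ), IsExpandingLift σ F ∧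
      ((∀ x : ℝ, T x = (F x : Torus)) ∨ ∀ x : ℝ, -T x = (F x : Torus)) := by
  obtain ⟨F, hF, hTF, σ, hσ, hF'⟩ := hT
  have hper : ∀ x, ((F (x + 2 * Real.pi) : ℝ) : Torus) = (F x : Torus) := fun x => by
    rw [← hTF, ← hTF, AddCircle.coe_add_period]
  have hc : Continuous (deriv F) := hF.continuous_deriv (by norm_num)
  have hsign : (∀ x, σ < deriv F x) ∨ ∀ x, σ < -deriv F x := by
    by_contra! hcon
    obtain ⟨⟨x, hx⟩, y, hy⟩ := hcon
    have hx' : deriv F x < -σ := by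
      rcases lt_abs.1 (hF' x) with h | h <;> linarith
    have hy' : σ < deriv F y := by
      rcases lt_abs.1 (hF' y) with h | h <;> linarith
    obtain ⟨z, hz⟩ := mem_range_of_exists_le_of_exists_ge hc (c := 0) ⟨x, by linarith⟩
      ⟨y, by linarith⟩
    have := hF' z
    rw [hz, abs_zero] at this
    linarith
  rcases hsign with h | h
  · exact ⟨σ, F, ⟨hF.of_le (by norm_num), hσ, h, hper⟩, Or.inl hTF⟩
  · refine ⟨σ, fun x => -F x, ⟨(hF.of_le (by norm_num)).neg, hσ, fun x => ?_, fun x => ?_⟩,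
      Or.inr fun x => ?_⟩
    · simpa using h x
    · rw [AddCircle.coe_neg, AddCircle.coe_neg, hper]
    · rw [hTF, AddCircle.coe_neg]

/-- The transfer operator of an expanding circle map contracts the log-Hölder constant. -/
theorem IsExpandingC4.exists_logHolder {T : Torus → Torus} (hT : IsExpandingC4 T) :
    ∃ s D : ℝ, 1 < s ∧ 0 ≤ D ∧ ∀ A, 0 ≤ A → ∀ u, LogHolder A u →
      ∃ v, LogHolder (A / s + D) v ∧
        ∀ E, MeasurableSet E → ∫ x in E, v x = ∫ x in T ⁻¹' E, u x := by
  have hTm := hT.measurable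
  obtain ⟨σ, F, hF, hTF⟩ := hT.exists_lift
  obtain ⟨B, hB0, hB⟩ := hF.exists_deriv_le_exp_mul
  obtain ⟨d, hd⟩ := hF.exists_degree
  refine ⟨√σ, B * √(2 * Real.pi), Real.lt_sqrt_of_sq_lt ?_, by positivity,
    fun A hA u hu => ?_⟩
  · rw [one_pow]; exact hF.one_lt
  have hv := hF.logHolder_branchSum hd hB0 hB hA hu
  rcases hTF with hTF | hTF
  · exact ⟨_, hv, fun E hE => hF.setIntegral_branchSum hd hTF hTm hu.continuous hE⟩
  · refine ⟨_, hv.comp_neg, fun E hE => ?_⟩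
    have h1 := hF.setIntegral_branchSum hd (T := fun x => -T x) hTF hTm.neg hu.continuous hE.neg
    have h2 := (Measure.measurePreserving_neg (volume : Measure Torus)).setIntegral_preimage_emb
      (MeasurableEquiv.neg Torus).measurableEmbedding (hF.periodic_branchSum hd u).lift (-E)
    have h3 : (Neg.neg ⁻¹' (-E) : Set Torus) = E := by ext; simp
    have h4 : (fun x => -T x) ⁻¹' (-E) = T ⁻¹' E := by ext; simp
    rw [h3] at h2
    rw [h4] at h1
    rw [← h1, ← h2]

theorem logHolder_const {A c : ℝ} (hA : 0 ≤ A) (hc : 0 ≤ c) : LogHolder A fun _ => c where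
  continuous := continuous_const
  nonneg _ := hc
  le _ t _ := le_mul_of_one_le_left hc (Real.one_le_exp (by positivity))

/-! ### The transfer operator on `L¹` -/

theorem L1Torus.integrable (f : L1Torus) : Integrable (f : Torus → ℝ) := L1.integrable_coeFn f

theorem Continuous.integrable_torus {E : Type*} [NormedAddCommGroup E] {u : Torus → E}
    (hu : Continuous u) : Integrable u :=
  hu.integrable_of_hasCompactSupport (HasCompactSupport.of_compactSpace u)

theorem L1Torus.ext_setIntegral {f g : L1Torus}
    (h : ∀ E, MeasurableSet E → ∫ x in E, f x = ∫ x in E, g x) : f = g :=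
  Lp.ext (Integrable.ae_eq_of_forall_setIntegral_eq _ _ f.integrable g.integrable
    fun E hE _ => h E hE)

theorem L1Torus.setIntegral_add (f g : L1Torus) (E : Set Torus) :
    ∫ x in E, (f + g : L1Torus) x = (∫ x in E, f x) + ∫ x in E, g x := by
  rw [integral_congr_ae (ae_restrict_of_ae (Lp.coeFn_add f g))]
  exact integral_add f.integrable.integrableOn g.integrable.integrableOn

theorem L1Torus.setIntegral_smul (c : ℝ) (f : L1Torus) (E : Set Torus) :
    ∫ x in E, (c • f : L1Torus) x = c * ∫ x in E, f x := by
  rw [integral_congr_ae (ae_restrict_of_ae (Lp.coeFn_smul c f))]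
  exact integral_const_mul _ _

theorem L1Torus.integral_add (f g : L1Torus) :
    ∫ x, (f + g : L1Torus) x = (∫ x, f x) + ∫ x, g x := by
  simpa using L1Torus.setIntegral_add f g Set.univ

theorem L1Torus.integral_smul (c : ℝ) (f : L1Torus) :
    ∫ x, (c • f : L1Torus) x = c * ∫ x, f x := by
  simpa using L1Torus.setIntegral_smul c f Set.univ

theorem L1Torus.integral_sub (f g : L1Torus) :
    ∫ x, (f - g : L1Torus) x = (∫ x, f x) - ∫ x, g x := by
  rw [sub_eq_add_neg, ← neg_one_smul ℝ g, L1Torus.integral_add, L1Torus.integral_smul]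
  ring

theorem L1Torus.norm_eq_integral (f : L1Torus) : ‖f‖ = ∫ x, |f x| := L1.norm_eq_integral_norm f

theorem L1Torus.norm_eq_integral_of_nonneg {f : L1Torus} (hf : ∀ᵐ x, 0 ≤ f x) :
    ‖f‖ = ∫ x, f x := by
  rw [f.norm_eq_integral]
  refine integral_congr_ae ?_
  filter_upwards [hf] with x hx using abs_of_nonneg hx

variable {T : Torus → Torus}

/-- The push-forward of Lebesgue measure has a density, obtained by transferring the constant `1`.
This nonsingularity is what makes the Radon–Nikodym derivative in `transferOp` recover the whole
push-forward. -/
theorem IsExpandingC4.volume_preimage_eq_zero (hT : IsExpandingC4 T) {E : Set Torus}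
    (hE : MeasurableSet E) (h0 : volume E = 0) : volume (T ⁻¹' E) = 0 := by
  obtain ⟨s, D, -, -, h⟩ := hT.exists_logHolder
  obtain ⟨v, -, hv⟩ := h 0 le_rfl _ (logHolder_const le_rfl zero_le_one)
  have := hv E hE
  rw [Measure.restrict_zero_set h0, integral_zero_measure, setIntegral_const, smul_eq_mul,
    mul_one, measureReal_def, eq_comm, ENNReal.toReal_eq_zero_iff] at this
  exact this.resolve_right (measure_ne_top _ _)

theorem IsExpandingC4.setIntegral_transferOp (hT : IsExpandingC4 T) (f : L1Torus) {E : Set Torus}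
    (hE : MeasurableSet E) : ∫ x in E, transferOp T f x = ∫ x in T ⁻¹' E, f x := by
  have hTm := hT.measurable
  set ν := VectorMeasure.map ((volume : Measure Torus).withDensityᵥ (f : Torus → ℝ)) T with hν
  have hνE : ∀ E, MeasurableSet E → ν E = ∫ x in T ⁻¹' E, f x := fun E hE => by
    rw [hν, VectorMeasure.map_apply _ hTm hE, withDensityᵥ_apply f.integrable (hTm hE)]
  have hac : VectorMeasure.AbsolutelyContinuous ν
      (volume : Measure Torus).toENNRealVectorMeasure := by
    refine VectorMeasure.AbsolutelyContinuous.mk fun E hE h0 => ?_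
    rw [Measure.toENNRealVectorMeasure_apply_measurable hE] at h0
    rw [hνE E hE, Measure.restrict_zero_set (hT.volume_preimage_eq_zero hE h0),
      integral_zero_measure]
  have hd := SignedMeasure.withDensityᵥ_rnDeriv_eq ν volume hac
  rw [← hνE E hE, ← hd, withDensityᵥ_apply (SignedMeasure.integrable_rnDeriv _ _) hE]
  exact integral_congr_ae (ae_restrict_of_ae (Integrable.coeFn_toL1 _))

theorem IsExpandingC4.transferOp_ae_eq (hT : IsExpandingC4 T) (f : L1Torus) {v : Torus → ℝ}
    (hv : Integrable v)
    (h : ∀ E, MeasurableSet E → ∫ x in E, v x = ∫ x in T ⁻¹' E, f x) : transferOp T f =ᵐ[volume] v :=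
  Integrable.ae_eq_of_forall_setIntegral_eq _ _ (L1Torus.integrable _) hv
    fun E hE _ => by rw [hT.setIntegral_transferOp f hE, h E hE]

theorem IsExpandingC4.integral_transferOp (hT : IsExpandingC4 T) (f : L1Torus) :
    ∫ x, transferOp T f x = ∫ x, f x := by
  simpa using hT.setIntegral_transferOp f MeasurableSet.univ

/-- Split the circle by the sign of the image `g`: on each part `∫ |g|` is up to sign an integral of
`f` over a preimage, and the two preimages are complementary. -/
theorem IsExpandingC4.norm_transferOp_le (hT : IsExpandingC4 T) (f : L1Torus) :
    ‖transferOp T f‖ ≤ ‖f‖ := by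
  set g := transferOp T f with hg
  have hP : MeasurableSet {x | 0 ≤ g x} :=
    (Lp.stronglyMeasurable g).measurable measurableSet_Ici
  have hle : ∀ E : Set Torus, |∫ x in E, f x| ≤ ∫ x in E, |f x| := fun E =>
    abs_integral_le_integral_abs
  rw [g.norm_eq_integral, f.norm_eq_integral, ← integral_add_compl hP g.integrable.abs,
    ← integral_add_compl (hT.measurable hP) f.integrable.abs]
  refine add_le_add ?_ ?_
  · rw [setIntegral_congr_fun hP (g := fun x => g x) fun x hx => abs_of_nonneg hx,
      hT.setIntegral_transferOp f hP]
    exact (le_abs_self _).trans (hle _)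
  · rw [setIntegral_congr_fun hP.compl (g := fun x => -g x) fun x hx =>
      abs_of_neg (not_le.1 hx), integral_neg, hT.setIntegral_transferOp f hP.compl]
    exact (neg_le_abs _).trans (hle _)

/-- The transfer operator of an expanding map as a bounded operator on `L¹`. -/
def IsExpandingC4.transferCLM (hT : IsExpandingC4 T) : L1Torus →L[ℝ] L1Torus :=
  LinearMap.mkContinuous
    { toFun := transferOp T
      map_add' := fun f g => L1Torus.ext_setIntegral fun E hE => by
        simp only [L1Torus.setIntegral_add, hT.setIntegral_transferOp _ hE]
      map_smul' := fun c f => L1Torus.ext_setIntegral fun E hE => by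
        simp only [L1Torus.setIntegral_smul, hT.setIntegral_transferOp _ hE, RingHom.id_apply] }
    1 fun f => by simpa using hT.norm_transferOp_le f

theorem IsExpandingC4.transferCLM_apply (hT : IsExpandingC4 T) (f : L1Torus) :
    hT.transferCLM f = transferOp T f := rfl

theorem IsExpandingC4.norm_transferCLM_pow_le (hT : IsExpandingC4 T) (n : ℕ) (f : L1Torus) :
    ‖(hT.transferCLM ^ n) f‖ ≤ ‖f‖ := by
  induction n generalizing f with
  | zero => simp
  | succ n ih =>
    rw [pow_succ, mul_apply_eq_comp]
    exact (ih _).trans (hT.norm_transferOp_le f)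

/-! ### Cones in `L¹` and exponential loss of memory -/

/-- Classes of functions with a representative in the cone `LogHolder A`. -/
def InCone (A : ℝ) (f : L1Torus) : Prop := ∃ u, LogHolder A u ∧ f =ᵐ[volume] u

theorem Torus.exists_eq_add (x y : Torus) : ∃ t : ℝ, |t| ≤ 2 * Real.pi ∧ y + t = x := by
  obtain ⟨b, hb, hbx⟩ := AddCircle.eq_coe_Ico (x - y)
  refine ⟨b, ?_, by rw [hbx]; abel⟩
  rw [abs_of_nonneg hb.1]; exact hb.2.le

theorem Torus.volume_real_univ : (volume : Measure Torus).real Set.univ = 2 * Real.pi := by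
  rw [measureReal_def, AddCircle.measure_univ, ENNReal.toReal_ofReal Real.two_pi_pos.le]

namespace LogHolder

variable {A : ℝ} {u : Torus → ℝ}

theorem mono (hu : LogHolder A u) {A' : ℝ} (h : A ≤ A') : LogHolder A' u where
  continuous := hu.continuous
  nonneg := hu.nonneg
  le x t ht := (hu.le x t ht).trans (mul_le_mul_of_nonneg_right
    (Real.exp_le_exp.2 (mul_le_mul_of_nonneg_right h (Real.sqrt_nonneg _))) (hu.nonneg _))

theorem le_exp_mul (hA : 0 ≤ A) (hu : LogHolder A u) (x y : Torus) :
    u x ≤ Real.exp (A * √(2 * Real.pi)) * u y := by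
  obtain ⟨t, ht, rfl⟩ := Torus.exists_eq_add x y
  exact (hu.le y t ht).trans (mul_le_mul_of_nonneg_right (Real.exp_le_exp.2
    (mul_le_mul_of_nonneg_left (Real.sqrt_le_sqrt ht) hA)) (hu.nonneg _))

theorem integral_le (hA : 0 ≤ A) (hu : LogHolder A u) (y : Torus) :
    ∫ x, u x ≤ 2 * Real.pi * (Real.exp (A * √(2 * Real.pi)) * u y) := by
  have := integral_mono hu.continuous.integrable_torus (integrable_const _)
    fun x => hu.le_exp_mul hA x y
  simpa [Torus.volume_real_univ] using this

/-- With `E = exp (A √|t|)`, the increment of `u` is at most `(E - 1) u x ≤ s (E - 1) (u x - c)`,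
since the hypothesis on `c` says `u x / s ≤ u x - c`. Bernoulli's inequality `1 + s (E - 1) ≤ E ^ s`
absorbs this into the exponent. -/
theorem sub_const (hA : 0 ≤ A) (hu : LogHolder A u) {s : ℝ} (hs : 1 ≤ s) {c : ℝ}
    (hc : ∀ x, c ≤ (1 - 1 / s) * u x) : LogHolder (s * A) fun x => u x - c where
  continuous := hu.continuous.sub continuous_const
  nonneg x := by
    have h1 : (1 - 1 / s) * u x ≤ 1 * u x :=
      mul_le_mul_of_nonneg_right (by linarith [show 0 ≤ 1 / s by positivity]) (hu.nonneg x)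
    linarith [hc x]
  le x t ht := by
    have hs0 : 0 < s := by linarith
    set E := Real.exp (A * √|t|) with hE
    have hE1 : 1 ≤ E := Real.one_le_exp (by positivity)
    have hpow : Real.exp (s * A * √|t|) = E ^ s := by
      rw [hE, ← Real.exp_mul]; ring_nf
    have hbern : 1 + s * (E - 1) ≤ E ^ s := by
      simpa using one_add_mul_self_le_rpow_one_add (s := E - 1) (by linarith) hs
    have h1 : u x / s ≤ u x - c := by
      have : (1 - 1 / s) * u x = u x - u x / s := by ring
      linarith [hc x]
    have h2 : (E - 1) * u x ≤ (E ^ s - 1) * (u x - c) := by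
      calc (E - 1) * u x = s * (E - 1) * (u x / s) := by field_simp
        _ ≤ _ := mul_le_mul (by linarith) h1 (div_nonneg (hu.nonneg x) hs0.le)
          (by nlinarith)
    rw [hpow]
    linarith [hu.le x t ht]

end LogHolder

theorem InCone.ae_nonneg {A : ℝ} {f : L1Torus} (hf : InCone A f) : ∀ᵐ x, 0 ≤ f x := by
  obtain ⟨u, hu, hfu⟩ := hf
  filter_upwards [hfu] with x hx
  rw [hx]; exact hu.nonneg x

theorem InCone.norm_eq {A : ℝ} {f : L1Torus} (hf : InCone A f) : ‖f‖ = ∫ x, f x :=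
  L1Torus.norm_eq_integral_of_nonneg hf.ae_nonneg

/-- Constant functions in `L¹`. -/
def L1Torus.const (c : ℝ) : L1Torus := Lp.const 1 volume c

theorem L1Torus.coeFn_const (c : ℝ) : L1Torus.const c =ᵐ[volume] fun _ => c :=
  Lp.coeFn_const _ _ _

theorem L1Torus.integral_const (c : ℝ) : ∫ x, L1Torus.const c x = 2 * Real.pi * c := by
  rw [integral_congr_ae (L1Torus.coeFn_const c), MeasureTheory.integral_const,
    Torus.volume_real_univ, smul_eq_mul]

/-- The Harnack-type bound `LogHolder.le_exp_mul` bounds `u` below by a multiple of its integral, so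
the constant removed depends on `f` only through its mass. -/
theorem InCone.sub_const {A : ℝ} (hA : 0 ≤ A) {f : L1Torus} (hf : InCone A f) {s : ℝ}
    (hs : 1 ≤ s) :
    InCone (s * A) (f - L1Torus.const
      ((1 - 1 / s) * (Real.exp (-(A * √(2 * Real.pi))) * (∫ x, f x) / (2 * Real.pi)))) := by
  obtain ⟨u, hu, hfu⟩ := hf
  set m := Real.exp (-(A * √(2 * Real.pi))) * (∫ x, f x) / (2 * Real.pi) with hm
  have hmu : ∀ x, m ≤ u x := fun x => by
    rw [hm, integral_congr_ae hfu, div_le_iff₀ Real.two_pi_pos, Real.exp_neg,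
      inv_mul_le_iff₀ (Real.exp_pos _)]
    linarith [hu.integral_le hA x]
  have hs' : 0 ≤ 1 - 1 / s := by
    rw [sub_nonneg, div_le_one (by linarith)]; exact hs
  refine ⟨_, hu.sub_const hA hs fun x => mul_le_mul_of_nonneg_left (hmu x) hs', ?_⟩
  filter_upwards [hfu, Lp.coeFn_sub f (L1Torus.const ((1 - 1 / s) * m)),
    L1Torus.coeFn_const ((1 - 1 / s) * m)] with x h1 h2 h3
  rw [h2, Pi.sub_apply, h1, h3]

/-- `f` has a bounded representative that is Hölder continuous of exponent `1 / 2`. -/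
def HasHolderRep (R B : ℝ) (f : L1Torus) : Prop :=
  ∃ u : Torus → ℝ, Continuous u ∧ (∀ x, |u x| ≤ R) ∧
    (∀ (x : Torus) (t : ℝ), |u (x + t) - u x| ≤ B * √|t|) ∧ f =ᵐ[volume] u

theorem HasHolderRep.mono {R B R' B' : ℝ} {f : L1Torus} (h : HasHolderRep R B f) (hR : R ≤ R')
    (hB : B ≤ B') : HasHolderRep R' B' f := by
  obtain ⟨u, h1, h2, h3, h4⟩ := h
  exact ⟨u, h1, fun x => (h2 x).trans hR, fun x t => (h3 x t).trans
    (mul_le_mul_of_nonneg_right hB (Real.sqrt_nonneg _)), h4⟩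

/-- After the shift the function is at least `B / A`, so its increment `B √|t|` is at most `A √|t|`
times its value, and `1 + x ≤ exp x` applies. -/
theorem HasHolderRep.inCone {R B A : ℝ} {f : L1Torus} (h : HasHolderRep R B f) (hA : 0 < A)
    (hB : 0 ≤ B) : InCone A (f + L1Torus.const (R + B / A)) := by
  obtain ⟨u, hc, hR, hH, hfu⟩ := h
  have h0 : ∀ x, B / A ≤ u x + (R + B / A) := fun x => by
    linarith [neg_le_of_abs_le (hR x)]
  refine ⟨fun x => u x + (R + B / A), ⟨by fun_prop, fun x => (by positivity : 0 ≤ B / A).trans (h0 x),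
    fun x t _ => ?_⟩, ?_⟩
  · have h1 : B ≤ A * (u x + (R + B / A)) := by
      have := h0 x
      rwa [div_le_iff₀' hA] at this
    have h2 : u (x + t) - u x ≤ B * √|t| := (le_abs_self _).trans (hH x t)
    have h3 := mul_le_mul_of_nonneg_right h1 (Real.sqrt_nonneg |t|)
    have h4 := mul_le_mul_of_nonneg_right (Real.add_one_le_exp (A * √|t|))
      ((by positivity : 0 ≤ B / A).trans (h0 x))
    linarith
  · filter_upwards [hfu, Lp.coeFn_add f (L1Torus.const (R + B / A)),
      L1Torus.coeFn_const (R + B / A)] with x h1 h2 h3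
    rw [h2, Pi.add_apply, h1, h3]

theorem HasHolderRep.integral_le {R B : ℝ} {f : L1Torus} (h : HasHolderRep R B f) :
    ∫ x, f x ≤ 2 * Real.pi * R := by
  obtain ⟨u, hc, hR, hH, hfu⟩ := h
  rw [integral_congr_ae hfu]
  have := integral_mono hc.integrable_torus (integrable_const R)
    fun x => (le_abs_self _).trans (hR x)
  simpa [Torus.volume_real_univ] using this

theorem IsExpandingC4.exists_inCone (hT : IsExpandingC4 T) :
    ∃ s D : ℝ, 1 < s ∧ 0 ≤ D ∧ ∀ A, 0 ≤ A → ∀ f, InCone A f →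
      InCone (A / s + D) (hT.transferCLM f) := by
  obtain ⟨s, D, hs, hD, h⟩ := hT.exists_logHolder
  refine ⟨s, D, hs, hD, fun A hA f ⟨u, hu, hfu⟩ => ?_⟩
  obtain ⟨v, hv, hint⟩ := h A hA u hu
  refine ⟨v, hv, hT.transferOp_ae_eq f hv.continuous.integrable_torus fun E hE => ?_⟩
  rw [hint E hE]
  exact integral_congr_ae (ae_restrict_of_ae hfu.symm)

/-- Exponential loss of memory for densities in a cone. -/
theorem IsExpandingC4.exists_cone_decay (hT : IsExpandingC4 T) :
    ∃ A ρ : ℝ, 0 < A ∧ 0 ≤ ρ ∧ ρ < 1 ∧ ∀ (n : ℕ) (f g : L1Torus), InCone A f → InCone A g →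
      ∫ x, f x = ∫ x, g x → ‖(hT.transferCLM ^ n) (f - g)‖ ≤ 2 * (∫ x, f x) * ρ ^ n := by
  obtain ⟨q, D, hq, hD, hcone⟩ := hT.exists_inCone
  -- The contraction `q` is split as `s * s`: one factor pays for the enlargement by `s` when a
  -- constant is subtracted, the other still contracts the cone.
  set s := √q with hs
  have hs1 : 1 < s := Real.lt_sqrt_of_sq_lt (by rwa [one_pow])
  have hsq : s * s = q := Real.mul_self_sqrt (by linarith)
  have hs' : 0 < 1 - 1 / s := by
    rw [sub_pos, div_lt_one (by linarith)]; exact hs1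
  -- Solves `A = A / s + D + 1`, so the cone is mapped into itself; the `+ 1` keeps `A` positive
  -- even when `D = 0`.
  set A := (D + 1) / (1 - 1 / s) with hA
  have hA0 : 0 < A := by positivity
  have hAD : A / s + D ≤ A := by
    have : A * (1 - 1 / s) = D + 1 := div_mul_cancel₀ _ hs'.ne'
    have : A * (1 - 1 / s) = A - A / s := by ring
    linarith
  set e := Real.exp (-(A * √(2 * Real.pi))) with he
  have he0 : 0 < e := Real.exp_pos _
  have he1 : e ≤ 1 := Real.exp_le_one_iff.2 (neg_nonpos.2 (by positivity))
  have hs'' : 1 - 1 / s ≤ 1 := by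
    have : 0 < 1 / s := by positivity
    linarith
  have hstep : ∀ f, InCone A f → InCone A (hT.transferCLM (f - L1Torus.const
      ((1 - 1 / s) * (e * (∫ x, f x) / (2 * Real.pi))))) := fun f hf => by
    obtain ⟨u, hu, hfu⟩ := hcone (s * A) (by positivity) _ (hf.sub_const hA0.le hs1.le)
    refine ⟨u, hu.mono (le_of_eq_of_le ?_ hAD), hfu⟩
    rw [← hsq, mul_div_mul_left _ _ (by positivity)]
  -- The fraction of mass removed is the same for every density, which gives the rate `ρ`.
  have hmass : ∀ f, ∫ x, hT.transferCLM (f - L1Torus.const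
      ((1 - 1 / s) * (e * (∫ x, f x) / (2 * Real.pi)))) x
      = (1 - (1 - 1 / s) * e) * ∫ x, f x := fun f => by
    rw [hT.transferCLM_apply, hT.integral_transferOp, L1Torus.integral_sub, L1Torus.integral_const]
    have := Real.pi_pos
    field_simp
  refine ⟨A, 1 - (1 - 1 / s) * e, hA0, ?_, by linarith [mul_pos hs' he0], fun n => ?_⟩
  · linarith [mul_le_one₀ hs'' he0.le he1]
  induction n with
  | zero =>
    intro f g hf hg hfg
    rw [pow_zero, pow_zero, one_apply_eq_self]
    refine (norm_sub_le f g).trans ?_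
    rw [hf.norm_eq, hg.norm_eq, hfg]
    linarith
  | succ n ih =>
    intro f g hf hg hfg
    have h := ih _ _ (hstep f hf) (hstep g hg) (by rw [hmass, hmass, hfg])
    -- Since `f` and `g` have equal mass, the subtracted constants coincide and cancel in the
    -- difference.
    rw [hmass, ← map_sub, ← mul_apply_eq_comp, ← pow_succ, hfg, sub_sub_sub_cancel_right] at h
    rw [hfg]
    refine h.trans (le_of_eq ?_)
    ring

/-- Exponential loss of memory for Hölder continuous densities. -/
theorem IsExpandingC4.exists_holder_decay (hT : IsExpandingC4 T) :
    ∃ ρ : ℝ, 0 ≤ ρ ∧ ρ < 1 ∧ ∀ R B : ℝ, 0 ≤ R → 0 ≤ B → ∃ K : ℝ, 0 ≤ K ∧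
      ∀ (f g : L1Torus), HasHolderRep R B f → HasHolderRep R B g → ∫ x, f x = ∫ x, g x →
        ∀ n : ℕ, ‖(hT.transferCLM ^ n) (f - g)‖ ≤ K * ρ ^ n := by
  obtain ⟨A, ρ, hA, hρ0, hρ1, h⟩ := hT.exists_cone_decay
  refine ⟨ρ, hρ0, hρ1, fun R B hR hB => ⟨2 * (2 * Real.pi * R + 2 * Real.pi * (R + B / A)),
    by have := Real.pi_pos; positivity, fun f g hf hg hfg n => ?_⟩⟩
  -- Adding the same constant to both functions puts them in the cone without changing their
  -- difference; the witness for `K` bounds twice the resulting mass.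
  have h1 := h n _ _ (hf.inCone hA hB) (hg.inCone hA hB)
    (by rw [L1Torus.integral_add, L1Torus.integral_add, hfg])
  rw [add_sub_add_right_eq_sub, L1Torus.integral_add, L1Torus.integral_const] at h1
  refine h1.trans (mul_le_mul_of_nonneg_right ?_ (pow_nonneg hρ0 n))
  linarith [hf.integral_le]

/-! ### Fourier series: Hölder representatives and density -/

/-- The pairing `φ ↦ ∫ φ F` of continuous functions with an integrable function. -/
def integralPairing (F : Torus → ℂ) (hF : Integrable F) : C(Torus, ℂ) →L[ℂ] ℂ :=
  have hint : ∀ φ : C(Torus, ℂ), Integrable fun x => φ x * F x := fun φ =>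
    hF.bdd_mul φ.continuous.aestronglyMeasurable (Filter.Eventually.of_forall φ.norm_coe_le_norm)
  LinearMap.mkContinuous
    { toFun := fun φ => ∫ x, φ x * F x
      map_add' := fun φ χ => by
        simp only [ContinuousMap.add_apply, add_mul]
        exact integral_add (hint φ) (hint χ)
      map_smul' := fun c φ => by
        simp only [ContinuousMap.smul_apply, smul_eq_mul, mul_assoc, RingHom.id_apply]
        exact integral_const_mul _ _ }
    (∫ x, ‖F x‖) fun φ => by
      refine (norm_integral_le_integral_norm _).trans ?_
      rw [← integral_mul_const]
      refine integral_mono (hint φ).norm (hF.norm.mul_const _) fun x => ?_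
      simp only [norm_mul]
      rw [mul_comm]
      exact mul_le_mul_of_nonneg_left (φ.norm_coe_le_norm x) (norm_nonneg _)

theorem integralPairing_apply (F : Torus → ℂ) (hF : Integrable F) (φ : C(Torus, ℂ)) :
    integralPairing F hF φ = ∫ x, φ x * F x := rfl

theorem dense_span_fourier :
    Dense (Submodule.span ℂ (Set.range (@fourier (2 * Real.pi))) : Set C(Torus, ℂ)) :=
  Submodule.dense_iff_topologicalClosure_eq_top.2 span_fourier_closure_eq_top

theorem integral_mul_eq_zero_of_fourier {F : Torus → ℂ} (hF : Integrable F)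
    (h : ∀ n, ∫ x, fourier n x * F x = 0) (φ : C(Torus, ℂ)) : ∫ x, φ x * F x = 0 := by
  have : integralPairing F hF = 0 := by
    refine ContinuousLinearMap.ext_on dense_span_fourier ?_
    rintro _ ⟨n, rfl⟩
    exact h n
  rw [← integralPairing_apply F hF, this]; rfl

/-- The positive and negative parts of `r` are densities of two finite measures with the same
integrals of bounded continuous functions; hence the measures, and the densities, agree. -/
theorem ae_eq_zero_of_integral_mul_eq_zero {r : Torus → ℝ} (hr : Integrable r)
    (h : ∀ φ : C(Torus, ℝ), ∫ x, φ x * r x = 0) : r =ᵐ[volume] 0 := by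
  have hfin : ∀ s : Torus → ℝ, Integrable s →
      ∫⁻ x, ENNReal.ofReal (s x) ≠ ⊤ := fun s hs => by
    refine ((lintegral_mono fun x => ?_).trans_lt hs.2).ne
    exact Real.ofReal_le_enorm _
  have hm : ∀ s : Torus → ℝ, Integrable s → AEMeasurable (fun x => ENNReal.ofReal (s x)) volume :=
    fun s hs => hs.1.aemeasurable.ennreal_ofReal
  have hint : ∀ s : Torus → ℝ, Integrable s → ∀ φ : Torus → ℝ,
      ∫ x, φ x ∂(volume.withDensity fun x => ENNReal.ofReal (s x)) = ∫ x, max (s x) 0 * φ x := by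
    intro s hs φ
    rw [integral_withDensity_eq_integral_toReal_smul₀ (hm s hs)
      (Filter.Eventually.of_forall fun _ => ENNReal.ofReal_lt_top)]
    simp only [ENNReal.toReal_ofReal', smul_eq_mul]
  have := isFiniteMeasure_withDensity (hfin r hr)
  have := isFiniteMeasure_withDensity (hfin _ hr.neg)
  have hext : (volume.withDensity fun x => ENNReal.ofReal (r x))
      = volume.withDensity fun x => ENNReal.ofReal ((-r) x) := by
    refine ext_of_forall_integral_eq_of_IsFiniteMeasure fun φ => ?_
    rw [hint r hr, hint _ hr.neg, ← sub_eq_zero]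
    have hb : ∀ s : Torus → ℝ, Integrable s → Integrable fun x => s x * φ x := fun s hs =>
      hs.mul_bdd φ.continuous.aestronglyMeasurable (Filter.Eventually.of_forall φ.norm_coe_le_norm)
    rw [← integral_sub (hb _ hr.pos_part) (hb _ hr.neg.pos_part)]
    refine Eq.trans ?_ (h φ.toContinuousMap)
    refine integral_congr_ae (Filter.Eventually.of_forall fun x => ?_)
    have : max (r x) 0 - max (-r x) 0 = r x := by
      rcases le_total 0 (r x) with h | h
      · rw [max_eq_left h, max_eq_right (by linarith), sub_zero]
      · rw [max_eq_right h, max_eq_left (by linarith)]; ring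
    change max (r x) 0 * φ x - max (-r x) 0 * φ x = φ x * r x
    rw [← sub_mul, this, mul_comm]
  have hae := (withDensity_eq_iff (hm r hr) (hm _ hr.neg) (hfin r hr)).1 hext
  filter_upwards [hae] with x hx
  rcases le_total 0 (r x) with h | h
  · rw [Pi.neg_apply, ENNReal.ofReal_of_nonpos (neg_nonpos.2 h), ENNReal.ofReal_eq_zero] at hx
    exact le_antisymm hx h
  · rw [Pi.neg_apply, ENNReal.ofReal_of_nonpos h, eq_comm, ENNReal.ofReal_eq_zero] at hx
    exact le_antisymm h (neg_nonpos.1 hx)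

theorem ae_re_eq_zero_of_fourier {F : Torus → ℂ} (hF : Integrable F)
    (h : ∀ n, ∫ x, fourier n x * F x = 0) : ∀ᵐ x, (F x).re = 0 := by
  refine ae_eq_zero_of_integral_mul_eq_zero hF.re fun φ => ?_
  have h1 := integral_mul_eq_zero_of_fourier hF h
    ((⟨Complex.ofReal, Complex.continuous_ofReal⟩ : C(ℝ, ℂ)).comp φ)
  have hint : Integrable fun x => (φ x : ℂ) * F x :=
    hF.bdd_mul (Complex.continuous_ofReal.comp φ.continuous).aestronglyMeasurable
      (c := ‖φ‖) (Filter.Eventually.of_forall fun x => by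
        simpa using φ.norm_coe_le_norm x)
  have h2 := congrArg Complex.re h1
  have h3 := integral_re hint
  simp only [ContinuousMap.comp_apply, ContinuousMap.coe_mk, Complex.zero_re] at h2
  rw [← h2]
  refine Eq.trans ?_ h3
  refine integral_congr_ae (Filter.Eventually.of_forall fun x => ?_)
  simp

theorem integral_fourier_mul_fourier (n m : ℤ) :
    ∫ x : Torus, fourier m x * fourier n x = if m = -n then (2 * Real.pi : ℂ) else 0 := by
  have h1 := congrFun (fourierCoeff_fourier (T := 2 * Real.pi) m) (-n)
  rw [fourierCoeff, AddCircle.integral_haarAddCircle, neg_neg] at h1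
  have h2 : ∫ x : Torus, fourier m x * fourier n x
      = (2 * Real.pi : ℂ) * ((Pi.single m 1 : ℤ → ℂ) (-n)) := by
    rw [← h1]
    have : (2 * Real.pi : ℂ) ≠ 0 := by exact_mod_cast Real.two_pi_pos.ne'
    rw [Complex.real_smul]
    push_cast
    rw [mul_inv_cancel_left₀ this]
    refine integral_congr_ae (Filter.Eventually.of_forall fun x => ?_)
    exact mul_comm _ _
  rw [h2, Pi.single_apply]
  by_cases hmn : m = -n
  · simp [hmn]
  · simp [hmn, Ne.symm hmn]

theorem fourier_coe_eq_exp (n : ℤ) (t : ℝ) :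
    fourier n (t : Torus) = Complex.exp (Complex.I * ((n * t : ℝ) : ℂ)) := by
  rw [fourier_coe_apply]
  congr 1
  have : (Real.pi : ℂ) ≠ 0 := by exact_mod_cast Real.pi_pos.ne'
  push_cast
  field_simp

theorem fourier_add_arg (n : ℤ) (x y : Torus) : fourier n (x + y) = fourier n x * fourier n y := by
  rw [fourier_apply, fourier_apply, fourier_apply, smul_add, AddCircle.toCircle_add, Circle.coe_mul]

theorem norm_fourier_apply (n : ℤ) (x : Torus) : ‖fourier n x‖ = 1 := by
  rw [fourier_apply]; exact Circle.norm_coe _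

/-- Interpolation: `|exp (is) - 1|` is at most both `|s|` and `2`, hence at most `2 √|s|`. Exponent
`1/2` costs only `√|n|`, which coefficients of order `n⁻²` can afford. -/
theorem norm_fourier_add_sub_le (n : ℤ) (x : Torus) (t : ℝ) :
    ‖fourier n (x + (t : Torus)) - fourier n x‖ ≤ 2 * (√|(n : ℝ)| * √|t|) := by
  rw [fourier_add_arg, ← mul_sub_one, norm_mul, norm_fourier_apply, one_mul]
  rw [← Real.sqrt_mul (abs_nonneg _), ← abs_mul]
  rcases le_total |(n : ℝ) * t| 1 with h | h
  · have h1 := Real.norm_exp_I_mul_ofReal_sub_one_le (x := (n : ℝ) * t)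
    rw [Real.norm_eq_abs, ← fourier_coe_eq_exp] at h1
    have h2 : |(n : ℝ) * t| ≤ √|(n : ℝ) * t| := Real.le_sqrt_of_sq_le (by nlinarith [abs_nonneg ((n : ℝ) * t)])
    linarith [Real.sqrt_nonneg |(n : ℝ) * t|]
  · have h1 := norm_sub_le (fourier n (t : Torus)) 1
    rw [norm_fourier_apply, norm_one] at h1
    have : 1 ≤ √|(n : ℝ) * t| := Real.one_le_sqrt.2 h
    linarith

/-- Fourier integrals of a real integrable function. -/
def fourierInt (f : L1Torus) (n : ℤ) : ℂ := ∫ x, fourier n x * ((f x : ℝ) : ℂ)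

theorem integrable_fourier_mul (f : L1Torus) (n : ℤ) :
    Integrable fun x : Torus => fourier n x * ((f x : ℝ) : ℂ) :=
  f.integrable.ofReal.bdd_mul (c := 1) (fourier n).continuous.aestronglyMeasurable
    (Filter.Eventually.of_forall fun x => (norm_fourier_apply n x).le)

theorem norm_fourierInt_le (f : L1Torus) (n : ℤ) : ‖fourierInt f n‖ ≤ ‖f‖ := by
  refine (norm_integral_le_integral_norm _).trans (le_of_eq ?_)
  rw [f.norm_eq_integral]
  refine integral_congr_ae (Filter.Eventually.of_forall fun x => ?_)
  simp [norm_fourier_apply, -fourier_apply]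

theorem circleDeriv_clm_fourier (ℓ : ℂ →L[ℝ] ℝ) (n : ℤ) (x : Torus) :
    circleDeriv (fun y => ℓ (fourier n y)) x = ℓ (Complex.I * n * fourier n x) := by
  have h1 : HasDerivAt (fun t : ℝ => fourier n (x + (t : Torus)))
      (Complex.I * n * fourier n x) 0 := by
    have h := (hasDerivAt_fourier (2 * Real.pi) n 0).const_mul (fourier n x)
    simp only [← fourier_add_arg] at h
    convert! h using 1
    have : (Real.pi : ℂ) ≠ 0 := by exact_mod_cast Real.pi_pos.ne'
    rw [AddCircle.coe_zero, fourier_eval_zero]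
    push_cast
    field_simp
  exact (ℓ.hasFDerivAt.comp_hasDerivAt (0 : ℝ) h1).deriv

theorem contDiff_clm_fourier (ℓ : ℂ →L[ℝ] ℝ) (n : ℤ) :
    ContDiff ℝ ∞ fun t : ℝ => ℓ (fourier n (t : Torus)) := by
  simp only [fourier_coe_eq_exp]
  refine ℓ.contDiff.comp (ContDiff.cexp ?_)
  exact contDiff_const.mul (Complex.ofRealCLM.contDiff.comp (contDiff_const.mul contDiff_id))

/-- Weak derivatives are tested against real functions only, so the exponential is first composed
with a real functional; real and imaginary parts are then the two instances needed. -/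
theorem HasWeakDeriv.clm_fourierInt {f g : L1Torus} (h : HasWeakDeriv f g) (ℓ : ℂ →L[ℝ] ℝ) (n : ℤ) :
    ℓ (Complex.I * n * fourierInt f n) = ℓ (-fourierInt g n) := by
  have h1 := h (fun y => ℓ (fourier n y)) (contDiff_clm_fourier ℓ n)
  simp only [circleDeriv_clm_fourier] at h1
  have hsmul : ∀ (c : ℝ) (z : ℂ), c * ℓ z = ℓ (z * c) := fun c z => by
    rw [mul_comm z, ← Complex.real_smul, map_smul, smul_eq_mul]
  simp only [hsmul] at h1
  rw [ℓ.integral_comp_comm (integrable_fourier_mul g n)] at h1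
  simp only [mul_assoc (Complex.I * n)] at h1
  rw [ℓ.integral_comp_comm ((integrable_fourier_mul f n).const_mul _),
    integral_const_mul] at h1
  rw [map_neg]
  exact h1

theorem HasWeakDeriv.fourierInt_eq {f g : L1Torus} (h : HasWeakDeriv f g) (n : ℤ) :
    Complex.I * n * fourierInt f n = -fourierInt g n :=
  Complex.ext (h.clm_fourierInt Complex.reCLM n) (h.clm_fourierInt Complex.imCLM n)

theorem HasWeakDeriv.norm_fourierInt {f g : L1Torus} (h : HasWeakDeriv f g) (n : ℤ) :
    |(n : ℝ)| * ‖fourierInt f n‖ = ‖fourierInt g n‖ := by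
  have := congrArg norm (h.fourierInt_eq n)
  rw [norm_neg, norm_mul, norm_mul, Complex.norm_I, one_mul, Complex.norm_intCast] at this
  exact this

theorem exists_hasWeakDeriv_of_sobolevNorm_lt {k : ℕ} {f : L1Torus} {c : ℝ≥0∞}
    (h : sobolevNorm (k + 1) f < c) :
    ‖f‖ₑ < c ∧ ∃ g, HasWeakDeriv f g ∧ sobolevNorm k g < c := by
  rw [sobolevNorm] at h
  refine ⟨lt_of_le_of_lt le_self_add h, ?_⟩
  have h2 := lt_of_le_of_lt le_add_self h
  simpa only [iInf_lt_iff, exists_prop] using h2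

theorem enorm_le_sobolevNorm (k : ℕ) (f : L1Torus) : ‖f‖ₑ ≤ sobolevNorm k f := by
  cases k with
  | zero => exact le_rfl
  | succ k => exact le_self_add

theorem hasHolderRep_of_summable {f : L1Torus} {R B : ℝ}
    (hs : Summable fun n => ‖fourierInt f n‖) (hR : ∑' n, ‖fourierInt f n‖ ≤ R)
    (hs' : Summable fun n : ℤ => ‖fourierInt f n‖ * √|(n : ℝ)|)
    (hB : ∑' n : ℤ, ‖fourierInt f n‖ * √|(n : ℝ)| ≤ B) : HasHolderRep R (2 * B) f := by
  have hpi : (2 * Real.pi : ℂ) ≠ 0 := by exact_mod_cast Real.two_pi_pos.ne'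
  have hnorm : ∀ n, ‖(2 * Real.pi : ℂ)⁻¹ * fourierInt f n‖ ≤ ‖fourierInt f n‖ := fun n => by
    rw [norm_mul]
    refine mul_le_of_le_one_left (norm_nonneg _) ?_
    rw [norm_inv]
    refine inv_le_one_of_one_le₀ ?_
    rw [norm_mul, Complex.norm_real, Complex.norm_ofNat, Real.norm_of_nonneg Real.pi_pos.le]
    linarith [Real.pi_gt_three]
  -- `fourierInt f n` pairs with `exp (inx)`, not its conjugate, so it is the coefficient of the
  -- character of index `-n`.
  set term : ℤ → C(Torus, ℂ) := fun n => ((2 * Real.pi : ℂ)⁻¹ * fourierInt f n) • fourier (-n)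
    with hterm
  have hsum : Summable term := by
    refine Summable.of_norm_bounded hs fun n => ?_
    rw [hterm, norm_smul, fourier_norm, mul_one]
    exact hnorm n
  set U : C(Torus, ℂ) := ∑' n, term n with hU
  have hUx : ∀ x, U x = ∑' n, term n x := fun x => (ContinuousMap.tsum_apply hsum x).symm
  have hsx : ∀ x, Summable fun n => term n x := fun x =>
    (ContinuousMap.hasSum_apply hsum.hasSum x).summable
  have hfU : ∀ n, ∫ x, fourier n x * (((f x : ℝ) : ℂ) - U x) = 0 := fun n => by
    have h1 : ∫ x, fourier n x * U x = fourierInt f n := by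
      have h2 := hsum.hasSum.mapL (integralPairing (fourier n) (fourier n).continuous.integrable_torus)
      have h3 := hasSum_single (f := fun m => integralPairing (fourier n)
        (fourier n).continuous.integrable_torus (term m)) n fun m hm => by
          rw [hterm, map_smul, integralPairing_apply, integral_fourier_mul_fourier, if_neg
            (fun h => hm (neg_injective h)), smul_zero]
      have h4 := h2.unique h3
      rw [integralPairing_apply, hterm, map_smul, integralPairing_apply,
        integral_fourier_mul_fourier, if_pos rfl, smul_eq_mul, mul_right_comm,
        inv_mul_cancel₀ hpi, one_mul] at h4
      rw [← h4]
      refine integral_congr_ae (Filter.Eventually.of_forall fun x => mul_comm _ _)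
    simp only [mul_sub]
    rw [integral_sub (integrable_fourier_mul f n) (by
      exact ((fourier n).continuous.mul U.continuous).integrable_torus), h1]
    exact sub_self _
  have hae := ae_re_eq_zero_of_fourier
    (f.integrable.ofReal.sub U.continuous.integrable_torus) hfU
  refine ⟨fun x => (U x).re, Complex.continuous_re.comp U.continuous, fun x => ?_, fun x t => ?_, ?_⟩
  · refine (Complex.abs_re_le_norm _).trans (le_trans ?_ hR)
    rw [hUx]
    refine tsum_of_norm_bounded hs.hasSum fun n => ?_
    rw [hterm, ContinuousMap.smul_apply, norm_smul, norm_fourier_apply, mul_one]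
    exact hnorm n
  · rw [← Complex.sub_re]
    refine (Complex.abs_re_le_norm _).trans ?_
    rw [hUx, hUx, ← (hsx _).tsum_sub (hsx _)]
    have : ‖∑' n, (term n (x + t) - term n x)‖
        ≤ (∑' n : ℤ, ‖fourierInt f n‖ * √|(n : ℝ)|) * (2 * √|t|) := by
      refine tsum_of_norm_bounded (hs'.hasSum.mul_right _) fun n => ?_
      rw [hterm, ContinuousMap.smul_apply, ContinuousMap.smul_apply, ← smul_sub, norm_smul]
      have h1 := norm_fourier_add_sub_le (-n) x t
      rw [Int.cast_neg, abs_neg] at h1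
      calc _ ≤ ‖fourierInt f n‖ * (2 * (√|(n : ℝ)| * √|t|)) :=
            mul_le_mul (hnorm n) h1 (norm_nonneg _) (norm_nonneg _)
        _ = _ := by ring
    refine this.trans ?_
    have := mul_le_mul_of_nonneg_right hB (show 0 ≤ 2 * √|t| by positivity)
    linarith
  · filter_upwards [hae] with x hx
    simp only [Pi.sub_apply, Complex.sub_re, sub_eq_zero] at hx
    simpa using hx

/-- Bounded sets of `W^{2,1}` consist of uniformly Hölder continuous functions. -/
theorem exists_hasHolderRep_of_sobolevNorm_lt (c : ℝ≥0) :
    ∃ R B : ℝ, 0 ≤ R ∧ 0 ≤ B ∧ ∀ (k : ℕ) (f : L1Torus), sobolevNorm (k + 2) f < c →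
      HasHolderRep R B f := by
  have hS : Summable fun n : ℤ => |(n : ℝ)| ^ (-(3 / 2 : ℝ)) :=
    Real.summable_abs_int_rpow (by norm_num)
  set S := ∑' n : ℤ, |(n : ℝ)| ^ (-(3 / 2 : ℝ)) with hSdef
  have hS0 : 0 ≤ S := tsum_nonneg fun n => by positivity
  -- The first `c` bounds the coefficient at `n = 0`, on which the derivatives give no information;
  -- the factor `2` comes from `norm_fourier_add_sub_le`.
  refine ⟨c + c * S, 2 * (c * S), by positivity, by positivity, fun k f hf => ?_⟩
  have hlt : ∀ g : L1Torus, ‖g‖ₑ < (c : ℝ≥0∞) → ‖g‖ ≤ c := fun g hg => by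
    rw [← ofReal_norm, ← ENNReal.ofReal_coe_nnreal] at hg
    exact (ENNReal.ofReal_lt_ofReal_iff'.1 hg).1.le
  obtain ⟨hfc, g, hfg, hg⟩ := exists_hasWeakDeriv_of_sobolevNorm_lt hf
  obtain ⟨-, h, hgh, hh⟩ := exists_hasWeakDeriv_of_sobolevNorm_lt hg
  have hhc := hlt h ((enorm_le_sobolevNorm k h).trans_lt hh)
  have hbound : ∀ n : ℤ, |(n : ℝ)| ^ 2 * ‖fourierInt f n‖ ≤ c := fun n => by
    rw [sq, mul_assoc, hfg.norm_fourierInt, hgh.norm_fourierInt]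
    exact (norm_fourierInt_le h n).trans hhc
  have h1 : ∀ n : ℤ, ‖fourierInt f n‖ * √|(n : ℝ)| ≤ c * |(n : ℝ)| ^ (-(3 / 2 : ℝ)) := fun n => by
    rcases eq_or_ne n 0 with rfl | hn
    · simp
    · have hn0 : 0 < |(n : ℝ)| := abs_pos.2 (by exact_mod_cast hn)
      have h2 : |(n : ℝ)| ^ (-(3 / 2 : ℝ)) = √|(n : ℝ)| / |(n : ℝ)| ^ 2 := by
        rw [Real.sqrt_eq_rpow, ← Real.rpow_natCast, ← Real.rpow_sub hn0]
        norm_num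
      rw [h2, mul_div_assoc', le_div_iff₀ (by positivity)]
      have := mul_le_mul_of_nonneg_right (hbound n) (Real.sqrt_nonneg |(n : ℝ)|)
      linarith
  have h3 : ∀ n : ℤ, ‖fourierInt f n‖
      ≤ (Pi.single 0 (c : ℝ) : ℤ → ℝ) n + c * |(n : ℝ)| ^ (-(3 / 2 : ℝ)) := fun n => by
    rcases eq_or_ne n 0 with rfl | hn
    · rw [Pi.single_eq_same]
      have : 0 ≤ (c : ℝ) * |((0 : ℤ) : ℝ)| ^ (-(3 / 2 : ℝ)) := by positivity
      linarith [(norm_fourierInt_le f 0).trans (hlt f hfc)]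
    · rw [Pi.single_eq_of_ne hn, zero_add]
      refine le_trans ?_ (h1 n)
      refine le_mul_of_one_le_right (norm_nonneg _) (Real.one_le_sqrt.2 ?_)
      exact_mod_cast Int.one_le_abs hn
  have hsum1 : HasSum (fun n : ℤ => (c : ℝ) * |(n : ℝ)| ^ (-(3 / 2 : ℝ))) (c * S) :=
    hS.hasSum.mul_left _
  have hsum2 : HasSum (fun n : ℤ => (Pi.single 0 (c : ℝ) : ℤ → ℝ) n
      + c * |(n : ℝ)| ^ (-(3 / 2 : ℝ))) (c + c * S) :=
    (hasSum_pi_single 0 (c : ℝ)).add hsum1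
  have hs : Summable fun n => ‖fourierInt f n‖ :=
    Summable.of_nonneg_of_le (fun _ => norm_nonneg _) h3 hsum2.summable
  have hs' : Summable fun n : ℤ => ‖fourierInt f n‖ * √|(n : ℝ)| :=
    Summable.of_nonneg_of_le (fun _ => by positivity) h1 hsum1.summable
  exact hasHolderRep_of_summable hs (hasSum_le h3 hs.hasSum hsum2) hs'
    (hasSum_le h1 hs'.hasSum hsum1)

/-- Hölder continuous functions are dense in `L¹`. -/
theorem dense_hasHolderRep : Dense {f : L1Torus | ∃ R B : ℝ, 0 ≤ R ∧ 0 ≤ B ∧ HasHolderRep R B f} := by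
  have hre : Continuous fun φ : C(Torus, ℂ) =>
      (⟨Complex.re, Complex.continuous_re⟩ : C(ℂ, ℝ)).comp φ := ContinuousMap.continuous_postcomp _
  have hre' : DenseRange fun φ : C(Torus, ℂ) =>
      (⟨Complex.re, Complex.continuous_re⟩ : C(ℂ, ℝ)).comp φ := by
    refine Function.Surjective.denseRange fun φ =>
      ⟨(⟨Complex.ofReal, Complex.continuous_ofReal⟩ : C(ℝ, ℂ)).comp φ, ?_⟩
    ext x
    simp
  have hLp := ContinuousMap.toLp_denseRange (μ := (volume : Measure Torus)) (E := ℝ) ℝ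
    (p := 1) ENNReal.one_ne_top
  -- The dense family consists of real parts of trigonometric polynomials.
  refine (hLp.dense_image (ContinuousMap.toLp 1 volume ℝ).continuous
    (hre'.dense_image hre dense_span_fourier)).mono ?_
  rintro _ ⟨_, ⟨p, hp, rfl⟩, rfl⟩
  have hB : ∃ B, 0 ≤ B ∧ ∀ (x : Torus) (t : ℝ), ‖p (x + t) - p x‖ ≤ B * √|t| := by
    induction hp using Submodule.span_induction with
    | mem p hp =>
      obtain ⟨n, rfl⟩ := hp
      refine ⟨2 * √|(n : ℝ)|, by positivity, fun x t => ?_⟩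
      rw [mul_assoc]
      exact norm_fourier_add_sub_le n x t
    | zero => exact ⟨0, le_rfl, fun x t => by simp⟩
    | add p q _ _ hp hq =>
      obtain ⟨B, hB, h⟩ := hp
      obtain ⟨B', hB', h'⟩ := hq
      refine ⟨B + B', by positivity, fun x t => ?_⟩
      rw [ContinuousMap.add_apply, ContinuousMap.add_apply, add_sub_add_comm, add_mul]
      exact (norm_add_le _ _).trans (add_le_add (h x t) (h' x t))
    | smul c p _ hp =>
      obtain ⟨B, hB, h⟩ := hp
      refine ⟨‖c‖ * B, by positivity, fun x t => ?_⟩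
      rw [ContinuousMap.smul_apply, ContinuousMap.smul_apply, ← smul_sub, norm_smul, mul_assoc]
      exact mul_le_mul_of_nonneg_left (h x t) (norm_nonneg _)
  obtain ⟨B, hB, h⟩ := hB
  refine ⟨‖p‖, B, norm_nonneg _, hB, fun x => (p x).re, Complex.continuous_re.comp p.continuous,
    fun x => (Complex.abs_re_le_norm _).trans (p.norm_coe_le_norm x), fun x t => ?_,
    ContinuousMap.coeFn_toLp _ _⟩
  rw [← Complex.sub_re]
  exact (Complex.abs_re_le_norm _).trans (h x t)

theorem HasHolderRep.smul {R B : ℝ} {f : L1Torus} (h : HasHolderRep R B f) (c : ℝ) :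
    HasHolderRep (|c| * R) (|c| * B) (c • f) := by
  obtain ⟨u, hc, hR, hH, hfu⟩ := h
  refine ⟨fun x => c * u x, by fun_prop, fun x => ?_, fun x t => ?_, ?_⟩
  · rw [abs_mul]
    exact mul_le_mul_of_nonneg_left (hR x) (abs_nonneg c)
  · rw [← mul_sub, abs_mul, mul_assoc]
    exact mul_le_mul_of_nonneg_left (hH x t) (abs_nonneg c)
  · filter_upwards [hfu, Lp.coeFn_smul c f] with x h1 h2
    rw [h2, Pi.smul_apply, h1, smul_eq_mul]

/-! ### The barycenter weight and fixed points -/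

theorem IsProbDensity.norm_eq_one {f : L1Torus} (hf : IsProbDensity f) : ‖f‖ = 1 := by
  rw [L1Torus.norm_eq_integral_of_nonneg hf.1, hf.2]

theorem baryWeight_eq (f : L1Torus) : baryWeight f = ‖fourierInt f 1‖ ^ 2 := rfl

theorem baryWeight_nonneg (f : L1Torus) : 0 ≤ baryWeight f := sq_nonneg _

theorem IsProbDensity.baryWeight_le_one {f : L1Torus} (hf : IsProbDensity f) :
    baryWeight f ≤ 1 := by
  rw [baryWeight_eq]
  exact pow_le_one₀ (norm_nonneg _) ((norm_fourierInt_le f 1).trans_eq hf.norm_eq_one)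

theorem fourierInt_sub (f g : L1Torus) (n : ℤ) :
    fourierInt (f - g) n = fourierInt f n - fourierInt g n := by
  rw [fourierInt, fourierInt, fourierInt,
    ← integral_sub (integrable_fourier_mul f n) (integrable_fourier_mul g n)]
  refine integral_congr_ae ?_
  filter_upwards [Lp.coeFn_sub f g] with x hx
  rw [hx, Pi.sub_apply]
  push_cast
  ring

/-- The weight vanishes to second order at `h`. Against the first-order bound on `‖f - h‖` in terms
of the weight, this is what excludes fixed points of positive weight. -/
theorem baryWeight_le_of_eq_zero (f : L1Torus) {h : L1Torus} (hh : baryWeight h = 0) :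
    baryWeight f ≤ ‖f - h‖ ^ 2 := by
  have h0 : fourierInt h 1 = 0 := by
    rw [baryWeight_eq] at hh
    exact norm_eq_zero.1 (pow_eq_zero_iff two_ne_zero |>.1 hh)
  have := norm_fourierInt_le (f - h) 1
  rw [fourierInt_sub, h0, sub_zero] at this
  rw [baryWeight_eq]
  exact pow_le_pow_left₀ (norm_nonneg _) this 2

theorem selfConsistentOp_of_le_one (T : Torus → Torus) (ψ : L1Torus → L1Torus) {δ : ℝ}
    {f : L1Torus} (hf : IsProbDensity f) (h : δ * baryWeight f ≤ 1) :
    selfConsistentOp T ψ δ f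
      = (1 - δ * baryWeight f) • transferOp T f + (δ * baryWeight f) • ψ f := by
  rw [selfConsistentOp, coupledOp, if_pos h, hf.2, mul_one]

/-- If the powers of a contraction `L` fixing `h` decay geometrically on `p - h`, then a solution
of `f = (1 - a) L f + a p` is within `O(a)` of `h`. -/
theorem norm_sub_le_of_eq_convexCombination {E : Type*} [NormedAddCommGroup E] [NormedSpace ℝ E]
    {L : E →L[ℝ] E} (hL : ∀ (n : ℕ) x, ‖(L ^ n) x‖ ≤ ‖x‖) {f h p : E} (hh : L h = h) {a : ℝ}
    (ha0 : 0 < a) (ha1 : a ≤ 1) (hf : (1 - a) • L f + a • p = f) {K ρ : ℝ} (hρ0 : 0 ≤ ρ)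
    (hρ1 : ρ < 1) (hK : 0 ≤ K) (hdecay : ∀ n : ℕ, ‖(L ^ n) (p - h)‖ ≤ K * ρ ^ n) :
    ‖f - h‖ ≤ a * (K * (1 - ρ)⁻¹) := by
  have hstep : f - h = (1 - a) • L (f - h) + a • (p - h) := by
    conv_lhs => rw [← hf]
    rw [map_sub, hh]
    module
  have hiter : ∀ n : ℕ, f - h = (1 - a) ^ n • (L ^ n) (f - h)
      + a • ∑ k ∈ Finset.range n, (1 - a) ^ k • (L ^ k) (p - h) := by
    intro n
    induction n with
    | zero => simp
    | succ n ih =>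
      have h1 : (L ^ n) (f - h) = (1 - a) • (L ^ (n + 1)) (f - h) + a • (L ^ n) (p - h) := by
        conv_lhs => rw [hstep]
        rw [map_add, map_smul, map_smul, pow_succ, mul_apply_eq_comp]
      conv_lhs => rw [ih]
      rw [h1, Finset.sum_range_succ]
      module
  have h1a : 0 ≤ 1 - a := by linarith
  have hbound : ∀ n : ℕ, ‖f - h‖ ≤ (1 - a) ^ n * ‖f - h‖ + a * (K * (1 - ρ)⁻¹) := by
    intro n
    conv_lhs => rw [hiter n]
    refine (norm_add_le _ _).trans (add_le_add ?_ ?_)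
    · rw [norm_smul, Real.norm_of_nonneg (pow_nonneg h1a n)]
      exact mul_le_mul_of_nonneg_left (hL n _) (pow_nonneg h1a n)
    · rw [norm_smul, Real.norm_of_nonneg ha0.le]
      refine mul_le_mul_of_nonneg_left ((norm_sum_le _ _).trans ?_) ha0.le
      calc ∑ k ∈ Finset.range n, ‖(1 - a) ^ k • (L ^ k) (p - h)‖
          ≤ ∑ k ∈ Finset.range n, K * ρ ^ k := Finset.sum_le_sum fun k _ => by
            rw [norm_smul, Real.norm_of_nonneg (pow_nonneg h1a k)]
            exact (mul_le_of_le_one_left (norm_nonneg _)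
              (pow_le_one₀ h1a (by linarith))).trans (hdecay k)
        _ = K * ∑ k ∈ Finset.range n, ρ ^ k := (Finset.mul_sum _ _ _).symm
        _ ≤ K * (1 - ρ)⁻¹ := by
            refine mul_le_mul_of_nonneg_left ?_ hK
            rw [← tsum_geometric_of_lt_one hρ0 hρ1]
            exact (summable_geometric_of_lt_one hρ0 hρ1).sum_le_tsum _
              fun k _ => pow_nonneg hρ0 k
  have hlim : Filter.Tendsto (fun n : ℕ => (1 - a) ^ n * ‖f - h‖ + a * (K * (1 - ρ)⁻¹))
      Filter.atTop (nhds (0 * ‖f - h‖ + a * (K * (1 - ρ)⁻¹))) :=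
    ((tendsto_pow_atTop_nhds_zero_of_lt_one h1a (by linarith)).mul_const _).add_const _
  -- Because `a > 0`, the factor `(1 - a) ^ n` kills the remainder; no decay of `L ^ n` on `f - h`
  -- itself is needed.
  rw [zero_mul, zero_add] at hlim
  exact ge_of_tendsto' hlim hbound

/-- An expanding map has at most one invariant probability density, given one that is Hölder. -/
theorem IsExpandingC4.eq_of_transferOp_eq (hT : IsExpandingC4 T) {h f : L1Torus}
    (hh : IsProbDensity h) (hhol : ∃ R B : ℝ, 0 ≤ R ∧ 0 ≤ B ∧ HasHolderRep R B h)
    (hinv : transferOp T h = h) (hf : IsProbDensity f) (hfinv : transferOp T f = f) : f = h := by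
  obtain ⟨ρ, hρ0, hρ1, hdecay⟩ := hT.exists_holder_decay
  obtain ⟨R, B, hR, hB, hhol⟩ := hhol
  have hpow : ∀ n : ℕ, (hT.transferCLM ^ n) (f - h) = f - h := by
    intro n
    induction n with
    | zero => simp
    | succ n ih =>
      rw [pow_succ, mul_apply_eq_comp, map_sub, hT.transferCLM_apply, hT.transferCLM_apply,
        hinv, hfinv, ih]
  rw [← sub_eq_zero, ← norm_le_zero_iff]
  refine le_of_forall_pos_le_add fun ε hε => ?_
  -- `f` is merely integrable, so the decay is applied to a Hölder approximation `g`, compared with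
  -- `m • h` of the same mass; the two errors are at most `‖f - g‖` each.
  obtain ⟨g, hgf, R', B', hR', hB', hg⟩ := Metric.dense_iff.1 dense_hasHolderRep f (ε / 2)
    (by positivity)
  rw [Metric.mem_ball', dist_eq_norm] at hgf
  set m := ∫ x, g x with hm
  have hhpow : ∀ n : ℕ, (hT.transferCLM ^ n) h = h := by
    intro n
    induction n with
    | zero => simp
    | succ n ih => rw [pow_succ, mul_apply_eq_comp, hT.transferCLM_apply, hinv, ih]
  have hmass : |m - 1| ≤ ‖f - g‖ := by
    rw [← hf.2, hm, abs_sub_comm, ← L1Torus.integral_sub, L1Torus.norm_eq_integral]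
    exact abs_integral_le_integral_abs
  obtain ⟨K, hK, hdec⟩ := hdecay (max R' (|m| * R)) (max B' (|m| * B)) (le_max_of_le_left hR')
    (le_max_of_le_left hB')
  have hbound : ∀ n : ℕ, ‖f - h‖ ≤ 2 * ‖f - g‖ + K * ρ ^ n := fun n => by
    have h1 : f - h = (hT.transferCLM ^ n) (f - g) + (hT.transferCLM ^ n) (g - m • h)
        + (m - 1) • h := by
      conv_lhs => rw [← hpow n]
      simp only [map_sub, map_smul, hhpow]
      module
    have h2 := hdec g (m • h) (hg.mono (le_max_left _ _) (le_max_left _ _))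
      ((hhol.smul m).mono (le_max_right _ _) (le_max_right _ _))
      (by rw [L1Torus.integral_smul, hh.2, mul_one]) n
    have h3 := hT.norm_transferCLM_pow_le n (f - g)
    have h4 : ‖(m - 1) • h‖ ≤ ‖f - g‖ := by
      rw [norm_smul, hh.norm_eq_one, mul_one]; exact hmass
    rw [h1]
    refine (norm_add₃_le).trans ?_
    linarith
  have hlim : Filter.Tendsto (fun n : ℕ => 2 * ‖f - g‖ + K * ρ ^ n) Filter.atTop
      (nhds (2 * ‖f - g‖ + K * 0)) :=
    ((tendsto_pow_atTop_nhds_zero_of_lt_one hρ0 hρ1).const_mul K).const_add _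
  have := ge_of_tendsto' hlim hbound
  linarith

theorem MemSobolev.exists_hasHolderRep {k : ℕ} {f : L1Torus} (hf : MemSobolev (k + 2) f) :
    ∃ R B : ℝ, 0 ≤ R ∧ 0 ≤ B ∧ HasHolderRep R B f := by
  obtain ⟨c, hc, -⟩ := ENNReal.lt_iff_exists_nnreal_btwn.1 hf
  obtain ⟨R, B, hR, hB, h⟩ := exists_hasHolderRep_of_sobolevNorm_lt c
  exact ⟨R, B, hR, hB, h k f hc⟩

end

/-! ### Uniqueness of the invariant density for weak coupling -/

theorem mainTheorem5
    (T : Torus → Torus) (hT : IsExpandingC4 T)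
    (ψ : ℝ → L1Torus → L1Torus) (M C : ℝ≥0)
    (hψ_prob : ∀ δ ∈ Set.Icc (0 : ℝ) 1, ∀ φ, IsProbDensity φ → IsProbDensity (ψ δ φ))
    (hψ_bound : ∀ δ ∈ Set.Icc (0 : ℝ) 1, ∀ φ, IsProbDensity φ → sobolevNorm 2 (ψ δ φ) ≤ M)
    (hψ_lip : ∀ δ ∈ Set.Icc (0 : ℝ) 1, ∀ φ₁ φ₂, IsProbDensity φ₁ → IsProbDensity φ₂ →
      sobolevNorm 1 (ψ δ φ₁ - ψ δ φ₂) ≤ C * ‖φ₁ - φ₂‖ₑ)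
    (h₀ : L1Torus) (h₀_prob : IsProbDensity h₀) (h₀_reg : MemSobolev 3 h₀)
    (h₀_inv : transferOp T h₀ = h₀) (h₀_weight : baryWeight h₀ = 0) :
    ∃ δbar : ℝ, 0 < δbar ∧ δbar < 1 ∧ ∀ δ : ℝ, 0 ≤ δ → δ ≤ δbar →
      ∀ f : L1Torus, IsProbDensity f → (selfConsistentOp T (ψ δ) δ f = f ↔ f = h₀) := by
  obtain ⟨ρ, hρ0, hρ1, hdecay⟩ := hT.exists_holder_decay
  obtain ⟨R₀, B₀, hR₀, hB₀, hh₀⟩ := MemSobolev.exists_hasHolderRep (k := 1) h₀_reg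
  -- `M + 1` turns the bound `≤ M` into the strict one required. The resulting `R`, `B`, and hence
  -- `K`, do not depend on `δ` or on the state.
  obtain ⟨R, B, hR, hB, hhol⟩ := exists_hasHolderRep_of_sobolevNorm_lt (M + 1)
  obtain ⟨K, hK, hdec⟩ := hdecay (max R R₀) (max B B₀) (le_max_of_le_left hR)
    (le_max_of_le_left hB)
  set K' := K * (1 - ρ)⁻¹ with hK'
  have hsq : 0 ≤ K' ^ 2 := sq_nonneg _
  -- With this bound, `δ K'² ≤ 1 - 2δ`, which is below `1` for `δ > 0`; the summand `2` also keeps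
  -- `δbar` below `1`.
  refine ⟨1 / (K' ^ 2 + 2), by positivity, ?_, fun δ hδ0 hδ f hf => ?_⟩
  · rw [div_lt_one (by positivity)]; linarith
  have hδK : δ * (K' ^ 2 + 2) ≤ 1 := by rwa [le_div_iff₀ (by positivity)] at hδ
  have hδ1 : δ ≤ 1 := by nlinarith
  have hW0 := baryWeight_nonneg f
  have hW1 := hf.baryWeight_le_one
  have ha1 : δ * baryWeight f ≤ 1 := mul_le_one₀ hδ1 hW0 hW1
  rw [selfConsistentOp_of_le_one T (ψ δ) hf ha1]
  refine ⟨fun hfix => ?_, ?_⟩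
  · rcases (mul_nonneg hδ0 hW0).eq_or_lt with ha | ha
    · rw [← ha, sub_zero, one_smul, zero_smul, add_zero] at hfix
      exact hT.eq_of_transferOp_eq h₀_prob ⟨R₀, B₀, hR₀, hB₀, hh₀⟩ h₀_inv hf hfix
    · exfalso
      have hψf : HasHolderRep R B (ψ δ f) := hhol 0 _ <|
        (hψ_bound δ ⟨hδ0, hδ1⟩ f hf).trans_lt (by exact_mod_cast lt_add_one M)
      have hclose : ‖f - h₀‖ ≤ δ * baryWeight f * K' :=
        norm_sub_le_of_eq_convexCombination (L := hT.transferCLM) hT.norm_transferCLM_pow_le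
          h₀_inv ha ha1 hfix hρ0 hρ1 hK <|
          hdec _ _ (hψf.mono (le_max_left _ _) (le_max_left _ _))
            (hh₀.mono (le_max_right _ _) (le_max_right _ _))
            ((hψ_prob δ ⟨hδ0, hδ1⟩ f hf).2.trans h₀_prob.2.symm)
      have hW := (baryWeight_le_of_eq_zero f h₀_weight).trans
        (pow_le_pow_left₀ (norm_nonneg _) hclose 2)
      have hWpos : 0 < baryWeight f := pos_of_mul_pos_right ha hδ0
      -- Dividing `W ≤ (δ W K')²` by `W > 0` leaves a lower bound incompatible with the smallness of
      -- `δ`.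
      have h1 : 1 ≤ δ * baryWeight f * (δ * K' ^ 2) := by
        refine le_of_mul_le_mul_right ?_ hWpos
        calc 1 * baryWeight f ≤ (δ * baryWeight f * K') ^ 2 := by rwa [one_mul]
          _ = _ := by ring
      have h2 : δ * baryWeight f * (δ * K' ^ 2) ≤ δ * K' ^ 2 :=
        mul_le_of_le_one_left (by positivity) ha1
      have h3 : 0 < δ := pos_of_mul_pos_left ha hW0
      linarith
  · rintro rfl
    rw [h₀_weight, mul_zero, sub_zero, one_smul, zero_smul, add_zero, h₀_inv]
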